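/- Let $d\ge 2$ be an integer. For $t>0$ let $$(e^{t\Delta}f)(x)=\int_{\mathbb R^d}(4\pi t)^{-d/2}e^{-|x-y|^2/(4t)}f(y)\,dy ,$$ and for $\beta\ge 0$ let $L^\infty(|x|^\beta dx)$ be the space of measurable $f:\mathbb R^d\to\mathbb R^d$ with $\operatorname{ess\,sup}_{x}|x|^\beta|f(x)|<\infty$. Let $R_j$ be the Riesz transform (the Fourier multiplier with symbol $i\xi_j/|\xi|$), let $(\mathbb P f)_j=f_j+\sum_{k}R_jR_kf_k$ be the Helmholtz–Leray projection, and put $(u\otimes v)_{kl}=u_kv_l$ and $(\nabla\cdot F)_k=\sum_l\partial_lF_{kl}$. The operator $e^{t\Delta}\mathbb P\nabla\cdot$ acts by convolution with its kernel, the inverse Fourier transform of its symbol. A global mild solution of the Navier–Stokes equations with initial datum $u_0$ is a measurable function $u:(0,\infty)\times\mathbb R^d\to\mathbb R^d$, $(t,x)\mapsto u(x,t)$, such that for all $t>0$ and $x\in\mathbb R^d$ the integrals in $$u(\cdot,t)=e^{t\Delta}u_0-\int_0^t e^{(t-\tau)\Delta}\,\mathbb P\,\nabla\cdot\big(u(\cdot,\tau)\otimes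 u(\cdot,\tau)\big)\,d\tau$$ converge absolutely at $x$ and the equation holds at $x$. **Theorem.** For every $\alpha$ with $0<\alpha<1$ there is a constant $\delta=\delta_{\alpha,d}>0$, depending only on $\alpha$ and $d$, such that the following holds for every $\beta$ with $1\le\beta<d$. If $u_0\in L^\infty(|x|\,dx)\cap L^\infty(|x|^\beta dx)$ satisfies $\operatorname{div}u_0=0$ in the sense of distributions and $$\sup_{x\in\mathbb R^d,\;t>0}|x|^\alpha\, t^{\frac{1-\alpha}{2}}\,|(e^{t\Delta}u_0)(x)|\le\delta ,$$ then the Navier–Stokes equations have a global mild solution $u$ with initial datum $u_0$ such that $$\sup_{x\in\mathbb R^d,\;t>0}\big(|x|+t^{1/2}\big)|u(x,t)|<\infty$$ and $$\sup_{x\in\mathbb R^d,\;0<t<T}|x|^\beta|u(x,t)|<\infty\qquad\text{for all }T\in(0,\infty).$$ -/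

import Mathlib

open MeasureTheory Set
open scoped FourierTransform ContDiff

noncomputable section

namespace WeightedNS

/-- `ℝ^d` with its Euclidean norm. -/
abbrev Space (d : ℕ) : Type := EuclideanSpace ℝ (Fin d)

/-- The heat kernel `(4πt)^{-d/2} e^{-|x|²/(4t)}`. -/
def heatKernel {d : ℕ} (t : ℝ) (x : Space d) : ℝ :=
  (4 * Real.pi * t) ^ (-(d : ℝ) / 2) * Real.exp (-‖x‖ ^ 2 / (4 * t))

/-- `(e^{tΔ} f)(x)`: convolution of the vector field `f` with the heat kernel. -/
def heat {d : ℕ} (t : ℝ) (f : Space d → Space d) (x : Space d) : Space d :=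
  ∫ y, heatKernel t (x - y) • f y

/-- `f ∈ L^∞(ℝ^d, |x|^β dx)`: `f` is (Lebesgue) measurable and
`ess sup |x|^β |f(x)|` is finite. -/
def MemWeightedLinfty {d : ℕ} (β : ℝ) (f : Space d → Space d) : Prop :=
  AEStronglyMeasurable f volume ∧ ∃ C : ℝ, ∀ᵐ x ∂volume, ‖x‖ ^ β * ‖f x‖ ≤ C

/-- `div f = 0` in the sense of distributions, for a locally integrable vector field `f`:
`∫ f · ∇φ = 0` for every real test function `φ`. -/
def DivFree {d : ℕ} (f : Space d → Space d) : Prop :=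
  ∀ φ : Space d → ℝ, ContDiff ℝ ∞ φ → HasCompactSupport φ →
    ∫ x, fderiv ℝ φ x (f x) = 0

/-! Fourier symbols. With the convention `𝓕 f ξ = ∫ e^{-2πi x·ξ} f x`, the symbols of `∂_l`, `R_j`
and `e^{tΔ}` are `2πi ξ_l`, `i ξ_j / |ξ|` and `e^{-4π² t |ξ|²}`. -/

/-- Symbol of the partial derivative `∂_l`. -/
def derivSymbol {d : ℕ} (l : Fin d) (ξ : Space d) : ℂ :=
  2 * (Real.pi : ℂ) * Complex.I * (ξ l : ℂ)

/-- Symbol of the Riesz transform `R_j = ∂_j / √(-Δ)`. -/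
def rieszSymbol {d : ℕ} (j : Fin d) (ξ : Space d) : ℂ :=
  Complex.I * (ξ j : ℂ) / (‖ξ‖ : ℂ)

/-- Symbol of the entry `(j, k)` of the Helmholtz-Leray projection,
`(ℙ f)_j = f_j + ∑_k R_j R_k f_k`. -/
def leraySymbol {d : ℕ} (j k : Fin d) (ξ : Space d) : ℂ :=
  (if j = k then 1 else 0) + rieszSymbol j ξ * rieszSymbol k ξ

/-- Symbol of `e^{tΔ}`. -/
def heatSymbol {d : ℕ} (t : ℝ) (ξ : Space d) : ℂ :=
  (Real.exp (-(4 * Real.pi ^ 2 * t * ‖ξ‖ ^ 2)) : ℂ)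

/-- The convolution kernel of the operator `F ↦ (e^{tΔ} ℙ_{jk} ∂_l) F`, i.e. the inverse Fourier
transform of its (integrable, for `t > 0`) symbol. The symbol takes conjugate values at `ξ` and
`-ξ`, so the inverse Fourier transform is real valued; `re` only changes the type. -/
def lerayHeatKernel {d : ℕ} (t : ℝ) (j k l : Fin d) (x : Space d) : ℝ :=
  (𝓕⁻ (fun ξ : Space d => heatSymbol t ξ * leraySymbol j k ξ * derivSymbol l ξ) x).re

/-- `(e^{tΔ} ℙ ∇·F)(x)` for a tensor field `F`, where `(∇·F)_k = ∑_l ∂_l F_{kl}`. -/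
def lerayHeatDiv {d : ℕ} (t : ℝ) (F : Space d → Matrix (Fin d) (Fin d) ℝ) (x : Space d) :
    Space d :=
  WithLp.toLp 2 fun j => ∑ k, ∑ l, ∫ y, lerayHeatKernel t j k l (x - y) * F y k l

/-- The tensor product `(u ⊗ v)_{kl} = u_k v_l` of two vector fields. -/
def tensor {d : ℕ} (u v : Space d → Space d) (y : Space d) : Matrix (Fin d) (Fin d) ℝ :=
  Matrix.of fun k l => u y k * v y l

/-- `u` (a function of `(t, x)`) is a mild solution of the Navier-Stokes equations on `[0, T]` with
initial datum `u₀`: it is measurable, and for all `0 < t ≤ T` and all `x`, the integrals in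
`u = e^{tΔ} u₀ - ∫₀ᵗ e^{(t-τ)Δ} ℙ ∇·(u(τ) ⊗ u(τ)) dτ`
converge absolutely and the equation holds. -/
structure IsMildSolutionOn {d : ℕ} (T : ℝ) (u₀ : Space d → Space d)
    (u : ℝ → Space d → Space d) : Prop where
  measurable : AEStronglyMeasurable (fun p : ℝ × Space d => u p.1 p.2)
    (volume.restrict (Ioc 0 T ×ˢ (univ : Set (Space d))))
  integrable_heat : ∀ t ∈ Ioc 0 T, ∀ x : Space d,
    Integrable (fun y => heatKernel t (x - y) • u₀ y) volume
  integrable_duhamel : ∀ t ∈ Ioc 0 T, ∀ x : Space d, ∀ j k l : Fin d,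
    IntegrableOn (fun p : ℝ × Space d =>
        lerayHeatKernel (t - p.1) j k l (x - p.2) * tensor (u p.1) (u p.1) p.2 k l)
      (Ioo 0 t ×ˢ (univ : Set (Space d))) volume
  eq : ∀ t ∈ Ioc 0 T, ∀ x : Space d,
    u t x = heat t u₀ x - ∫ τ in (0 : ℝ)..t, lerayHeatDiv (t - τ) (tensor (u τ) (u τ)) x

/-- A global mild solution: a mild solution on `[0, T]` for every `T > 0`. -/
def IsGlobalMildSolution {d : ℕ} (u₀ : Space d → Space d) (u : ℝ → Space d → Space d) : Prop :=
  ∀ T : ℝ, 0 < T → IsMildSolutionOn T u₀ u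

end WeightedNS

end

/-!
The solution is the limit of the Picard iterates of `u = w - B(u, u)`, where `w(t) = e^{tΔ} u₀` and
`B(u, v) = ∫_0^t e^{(t-τ)Δ} ℙ ∇·(u ⊗ v) dτ`.

*The kernel.* The kernel `K_s` of `e^{sΔ} ℙ ∇·` satisfies `|K_s(z)| ≤ C (|z| + √s)^{-(d+1)}`
(`exists_lerayHeatKernel_le`). By parabolic scaling only `s = 1` matters. The identity
`e^{-4π²|ξ|²} / |ξ|² = 4π² ∫_1^∞ e^{-4π²s|ξ|²} ds` writes the part of the symbol not smooth at the
origin as a superposition of rescaled copies of the Schwartz function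
`ξ_j ξ_k ξ_l e^{-4π²|ξ|²}`, and integrating the Schwartz decay of the inverse Fourier transforms
over `s` gives the decay `|z|^{-(d+1)}`.

*The estimates.* For `0 ≤ γ < d`, convolving `|y|^{-γ}` with `(|z| + √s)^{-(d+1)}` gives at most
`C s^{-1/2} (|x| + √s)^{-γ}` (`exists_integral_convolution_rpow_le`). Together with a Beta integral in
time this shows that `B` is bounded in the scale-invariant norms
`‖u‖_a = sup |x|^a t^{(1-a)/2} |u(t,x)|`, `0 ≤ a ≤ 1`, as soon as one factor is measured in `‖·‖_α`:
`‖B(u, v)‖_a ≤ C ‖u‖_α ‖v‖_a` (`exists_criticalBound_duhamel`). So smallness of `‖w‖_α` alone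
keeps the iterates bounded in `‖·‖_α`, `‖·‖_0` and `‖·‖_1`, and makes their differences decay
geometrically in `‖·‖_0`, which is pointwise convergence at every `(t, x)` with `t > 0`
(`exists_tendsto_picard`). The bounds with `a = 0` and `a = 1` add up to the bound of
`(|x| + √t) |u|`.

*The weight `|x|^β`.* Since `δ` may not depend on `β`, smallness is produced differently. For
`|x| ≤ 1` the weight is dominated by `|x|`. For `|x| ≥ 1`, interpolating `a = 0` and `a = 1` gives
`|u| ≤ N |y|^{-a} τ^{-(1-a)/2}` for an `a > 0` with `a + β < d`. Dropping the factor
`|x|^{-a} ≤ 1` leaves a subcritical time integral, and in the norm `sup e^{-λt} |x|^β |u(t,x)|` the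
Duhamel term carries the factor `λ^{-a/2}` (`exists_norm_duhamel_exp_le`), which is small for large
`λ` (`exists_pow_mul_norm_picard_le`).
-/

noncomputable section

namespace WeightedNS

variable {d : ℕ}

/-! ### Gaussian symbols and the Fourier transform -/

/-- A polynomial times a decaying Gaussian is bounded. -/
lemma exists_one_add_pow_mul_exp_neg_le (N : ℕ) {c : ℝ} (hc : 0 < c) :
    ∃ B : ℝ, 0 < B ∧ ∀ r : ℝ, 0 ≤ r → (1 + r) ^ N * Real.exp (-(c * r ^ 2)) ≤ B := by
  refine ⟨N.factorial * Real.exp (1 + 1 / (4 * c)), by positivity, fun r hr => ?_⟩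
  have h1 : (1 + r) ^ N ≤ N.factorial * Real.exp (1 + r) := by
    have := Real.pow_div_factorial_le_exp (1 + r) (by positivity) N
    rwa [div_le_iff₀ (by positivity), mul_comm] at this
  calc (1 + r) ^ N * Real.exp (-(c * r ^ 2))
      ≤ N.factorial * Real.exp (1 + r) * Real.exp (-(c * r ^ 2)) := by gcongr
    _ = N.factorial * Real.exp (1 + r - c * r ^ 2) := by
        rw [mul_assoc, ← Real.exp_add]; ring_nf
    _ ≤ _ := by
        gcongr
        have h2 : r - c * r ^ 2 = 1 / (4 * c) - c * (r - 1 / (2 * c)) ^ 2 := by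
          field_simp; ring
        nlinarith [sq_nonneg (r - 1 / (2 * c))]

/-- Decay of the derivatives of a Gaussian, by the Faà di Bruno bound for `exp ∘ (-c |·|²)`; only the
polynomial growth of the derivatives of `|x|²` is needed. -/
lemma exists_pow_mul_iteratedFDeriv_gaussian_le {E : Type*} [NormedAddCommGroup E]
    [InnerProductSpace ℝ E] {c : ℝ} (hc : 0 < c) (k n : ℕ) :
    ∃ C : ℝ, ∀ x : E,
      ‖x‖ ^ k * ‖iteratedFDeriv ℝ n (fun x : E => Real.exp (-(c * ‖x‖ ^ 2))) x‖ ≤ C := by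
  obtain ⟨m, A, hA, hm⟩ :=
    (Function.hasTemperateGrowth_norm_sq (H := E)).norm_iteratedFDeriv_le_uniform n
  obtain ⟨B, hB, hBr⟩ := exists_one_add_pow_mul_exp_neg_le (k + m * n) hc
  refine ⟨n.factorial * (1 + c) ^ n * (1 + A) ^ n * B, fun x => ?_⟩
  have hg : ContDiff ℝ ∞ (fun u : ℝ => Real.exp ((-c) * u)) := by fun_prop
  have key := norm_iteratedFDeriv_comp_le (n := n) hg
    (Function.hasTemperateGrowth_norm_sq (H := E)).1 (by exact_mod_cast le_top) x
    (C := (1 + c) ^ n * Real.exp (-(c * ‖x‖ ^ 2))) (D := (1 + A) * (1 + ‖x‖) ^ m)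
    (fun i hi => by
      rw [norm_iteratedFDeriv_eq_norm_iteratedDeriv, iteratedDeriv_exp_const_mul, norm_mul,
        norm_pow, Real.norm_eq_abs, Real.norm_eq_abs, Real.abs_exp, abs_neg, abs_of_pos hc,
        neg_mul]
      gcongr
      calc c ^ i ≤ (1 + c) ^ i := by gcongr; linarith
        _ ≤ (1 + c) ^ n := pow_le_pow_right₀ (by linarith) hi)
    (fun i hi hin => by
      have h1 : 1 ≤ (1 + A) * (1 + ‖x‖) ^ m :=
        one_le_mul_of_one_le_of_one_le (by linarith) (one_le_pow₀ (by linarith [norm_nonneg x]))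
      calc _ ≤ A * (1 + ‖x‖) ^ m := hm i hin x
        _ ≤ (1 + A) * (1 + ‖x‖) ^ m := by gcongr; linarith
        _ ≤ _ := le_self_pow₀ h1 (by omega))
  have he : (fun u : ℝ => Real.exp ((-c) * u)) ∘ (fun x : E => ‖x‖ ^ 2) =
      fun x : E => Real.exp (-(c * ‖x‖ ^ 2)) := by
    ext y; simp
  rw [he] at key
  calc _ ≤ (1 + ‖x‖) ^ k * (n.factorial * ((1 + c) ^ n * Real.exp (-(c * ‖x‖ ^ 2))) *
          ((1 + A) * (1 + ‖x‖) ^ m) ^ n) := by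
        gcongr; linarith
    _ = n.factorial * (1 + c) ^ n * (1 + A) ^ n *
          ((1 + ‖x‖) ^ (k + m * n) * Real.exp (-(c * ‖x‖ ^ 2))) := by
        rw [mul_pow, ← pow_mul, pow_add]; ring
    _ ≤ _ := by gcongr; exact hBr _ (norm_nonneg x)

/-- The Gaussian `e^{-c|x|²}` as a Schwartz function. -/
def gaussianSchwartz (E : Type*) [NormedAddCommGroup E] [InnerProductSpace ℝ E] {c : ℝ}
    (hc : 0 < c) : SchwartzMap E ℝ where
  toFun := fun x => Real.exp (-(c * ‖x‖ ^ 2))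
  smooth' := Real.contDiff_exp.comp
    ((contDiff_const.mul (Function.hasTemperateGrowth_norm_sq (H := E)).1).neg)
  decay' := exists_pow_mul_iteratedFDeriv_gaussian_le hc

lemma gaussianSchwartz_apply {E : Type*} [NormedAddCommGroup E] [InnerProductSpace ℝ E] {c : ℝ}
    (hc : 0 < c) (x : E) : gaussianSchwartz E hc x = Real.exp (-(c * ‖x‖ ^ 2)) := rfl

/-- A polynomially growing multiple of the symbol of `e^Δ` is a Schwartz function. -/
lemma exists_schwartz_eq_heatSymbol_mul {P : Space d → ℂ} (hP : P.HasTemperateGrowth) :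
    ∃ f : SchwartzMap (Space d) ℂ, ∀ ξ, f ξ = heatSymbol 1 ξ * P ξ := by
  refine ⟨SchwartzMap.smulLeftCLM ℂ P ((gaussianSchwartz (Space d)
    (c := 4 * Real.pi ^ 2) (by positivity)).postcompCLM Complex.ofRealCLM), fun ξ => ?_⟩
  rw [SchwartzMap.smulLeftCLM_apply_apply hP, SchwartzMap.postcompCLM_apply, smul_eq_mul,
    mul_comm]
  simp [gaussianSchwartz_apply, heatSymbol]

lemma heatSymbol_smul (s r : ℝ) (ξ : Space d) :
    heatSymbol s (r • ξ) = heatSymbol (r ^ 2 * s) ξ := by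
  simp only [heatSymbol, norm_smul, mul_pow, Real.norm_eq_abs, sq_abs]
  congr 3; ring

lemma derivSymbol_smul (l : Fin d) (r : ℝ) (ξ : Space d) :
    derivSymbol l (r • ξ) = r * derivSymbol l ξ := by
  simp [derivSymbol]; ring

lemma leraySymbol_smul (j k : Fin d) {r : ℝ} (hr : 0 < r) (ξ : Space d) :
    leraySymbol j k (r • ξ) = leraySymbol j k ξ := by
  have hr' : (r : ℂ) ≠ 0 := by exact_mod_cast hr.ne'
  have (j : Fin d) : rieszSymbol j (r • ξ) = rieszSymbol j ξ := by
    simp only [rieszSymbol, norm_smul, Real.norm_eq_abs, abs_of_pos hr, PiLp.smul_apply,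
      smul_eq_mul, Complex.ofReal_mul]
    rw [mul_left_comm, mul_div_mul_left _ _ hr']
  simp [leraySymbol, this]

lemma fourierInv_comp_smul (f : Space d → ℂ) {r : ℝ} (hr : 0 < r) (x : Space d) :
    𝓕⁻ (fun ξ => f (r • ξ)) x = ((r ^ d)⁻¹ : ℝ) * 𝓕⁻ f (r⁻¹ • x) := by
  rw [Real.fourierInv_eq', Real.fourierInv_eq']
  have := Measure.integral_comp_smul_of_nonneg (volume : Measure (Space d))
    (fun v => Complex.exp (((2 * Real.pi * inner ℝ v (r⁻¹ • x) : ℝ) : ℂ) * Complex.I) • f v) r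
    (hR := hr.le)
  rw [finrank_euclideanSpace_fin, Complex.real_smul] at this
  rw [← this]
  congr 1; ext v
  rw [inner_smul_left, inner_smul_right]
  simp [hr.ne']

lemma measurable_heatSymbol :
    Measurable fun p : ℝ × Space d => heatSymbol p.1 p.2 := by
  unfold heatSymbol; fun_prop

lemma measurable_leraySymbol (j k : Fin d) : Measurable (leraySymbol j k) := by
  unfold leraySymbol rieszSymbol; fun_prop

lemma measurable_derivSymbol (l : Fin d) : Measurable (derivSymbol l) := by
  unfold derivSymbol; fun_prop

lemma measurable_lerayHeatKernel (j k l : Fin d) :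
    Measurable fun p : ℝ × Space d => lerayHeatKernel p.1 j k l p.2 := by
  unfold lerayHeatKernel
  refine Complex.measurable_re.comp (StronglyMeasurable.measurable ?_)
  simp_rw [Real.fourierInv_eq']
  refine StronglyMeasurable.integral_prod_right'
    (f := fun q : (ℝ × Space d) × Space d =>
      Complex.exp (((2 * Real.pi * inner ℝ q.2 q.1.2 : ℝ) : ℂ) * Complex.I) •
        (heatSymbol q.1.1 q.2 * leraySymbol j k q.2 * derivSymbol l q.2)) ?_
  have h1 : Measurable fun q : (ℝ × Space d) × Space d => (inner ℝ q.2 q.1.2 : ℝ) :=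
    (by fun_prop : Continuous fun q : (ℝ × Space d) × Space d => (inner ℝ q.2 q.1.2 : ℝ)).measurable
  have h2 := measurable_heatSymbol.comp
    (by fun_prop : Measurable fun q : (ℝ × Space d) × Space d => (q.1.1, q.2))
  have h3 := (measurable_leraySymbol j k).comp
    (measurable_snd : Measurable fun q : (ℝ × Space d) × Space d => q.2)
  have h4 := (measurable_derivSymbol l).comp
    (measurable_snd : Measurable fun q : (ℝ × Space d) × Space d => q.2)
  have h5 : Measurable fun q : (ℝ × Space d) × Space d =>
      Complex.exp (((2 * Real.pi * inner ℝ q.2 q.1.2 : ℝ) : ℂ) * Complex.I) := by fun_prop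
  exact (h5.smul ((h2.mul h3).mul h4)).stronglyMeasurable

lemma norm_fourierInv_le (f : Space d → ℂ) (x : Space d) : ‖𝓕⁻ f x‖ ≤ ∫ ξ, ‖f ξ‖ := by
  rw [Real.fourierInv_eq']
  refine (norm_integral_le_integral_norm _).trans_eq ?_
  congr 1; ext v
  rw [norm_smul, Complex.norm_exp_ofReal_mul_I, one_mul]

lemma abs_apply_le_norm (ξ : Space d) (j : Fin d) : |ξ j| ≤ ‖ξ‖ := by
  simpa using PiLp.norm_apply_le ξ j

lemma hasTemperateGrowth_coord (j : Fin d) :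
    (fun ξ : Space d => ((ξ j : ℝ) : ℂ)).HasTemperateGrowth :=
  (Complex.ofRealCLM.comp (EuclideanSpace.proj (𝕜 := ℝ) j)).hasTemperateGrowth

lemma hasTemperateGrowth_derivSymbol (l : Fin d) :
    (derivSymbol l : Space d → ℂ).HasTemperateGrowth :=
  (Function.HasTemperateGrowth.const _).mul (hasTemperateGrowth_coord l)

/-! ### Parabolic scaling and the Leray symbol as a superposition of Gaussians -/

lemma fourierInv_const_mul (c : ℂ) (f : Space d → ℂ) (x : Space d) :
    𝓕⁻ (fun ξ => c * f ξ) x = c * 𝓕⁻ f x := by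
  rw [Real.fourierInv_eq', Real.fourierInv_eq', ← integral_const_mul]
  congr 1; ext v; simp only [smul_eq_mul]; ring

lemma heatSymbol_mul_eq_of_homogeneous {P : Space d → ℂ} {m : ℕ}
    (hP : ∀ r : ℝ, 0 < r → ∀ ξ, P (r • ξ) = (r : ℂ) ^ m * P ξ) {r : ℝ} (hr : 0 < r) (ξ : Space d) :
    heatSymbol (r ^ 2) ξ * P ξ =
      ((r ^ m)⁻¹ : ℝ) * (heatSymbol 1 (r • ξ) * P (r • ξ)) := by
  rw [heatSymbol_smul, hP r hr, mul_one]
  have hr' : (r : ℂ) ≠ 0 := by exact_mod_cast hr.ne'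
  push_cast
  field_simp

/-- Parabolic scaling of the kernel of `P(∇/i) e^{tΔ}` for a homogeneous symbol `P`. -/
lemma fourierInv_heatSymbol_mul_of_homogeneous {P : Space d → ℂ} {m : ℕ}
    (hP : ∀ r : ℝ, 0 < r → ∀ ξ, P (r • ξ) = (r : ℂ) ^ m * P ξ) {r : ℝ} (hr : 0 < r) (x : Space d) :
    𝓕⁻ (fun ξ => heatSymbol (r ^ 2) ξ * P ξ) x =
      ((r ^ (d + m))⁻¹ : ℝ) * 𝓕⁻ (fun ξ => heatSymbol 1 ξ * P ξ) (r⁻¹ • x) := by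
  simp_rw [heatSymbol_mul_eq_of_homogeneous hP hr]
  rw [fourierInv_const_mul, fourierInv_comp_smul (fun ξ => heatSymbol 1 ξ * P ξ) hr, ← mul_assoc]
  congr 1
  rw [pow_add]; push_cast; rw [mul_inv, mul_comm]

/-- All polynomial decay rates for the kernel of a homogeneous symbol times the heat symbol at time
`r²`, uniformly in `r`: the case `r = 1` is Schwartz decay, and the rest is scaling. -/
lemma exists_pow_mul_norm_fourierInv_le {P : Space d → ℂ} (hPg : P.HasTemperateGrowth) {m : ℕ}
    (hP : ∀ r : ℝ, 0 < r → ∀ ξ, P (r • ξ) = (r : ℂ) ^ m * P ξ) (N : ℕ) :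
    ∃ C : ℝ, 0 < C ∧ ∀ (r : ℝ), 0 < r → ∀ x : Space d,
      ‖x‖ ^ N * ‖𝓕⁻ (fun ξ => heatSymbol (r ^ 2) ξ * P ξ) x‖ ≤ C * r ^ N * (r ^ (d + m))⁻¹ := by
  obtain ⟨f, hf⟩ := exists_schwartz_eq_heatSymbol_mul hPg
  obtain ⟨C, hC, h⟩ := (𝓕⁻ f).decay N 0
  refine ⟨C, hC, fun r hr x => ?_⟩
  rw [fourierInv_heatSymbol_mul_of_homogeneous hP hr]
  have h1 := h (r⁻¹ • x)
  rw [norm_iteratedFDeriv_zero, SchwartzMap.fourierInv_coe, show (f : Space d → ℂ) =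
    fun ξ => heatSymbol 1 ξ * P ξ from funext hf, norm_smul, norm_inv, Real.norm_eq_abs,
    abs_of_pos hr, mul_pow, inv_pow, inv_mul_eq_div, div_mul_eq_mul_div,
    div_le_iff₀ (by positivity)] at h1
  rw [norm_mul, Complex.norm_real, Real.norm_of_nonneg (by positivity), mul_left_comm, mul_comm]
  gcongr

lemma integrable_heatSymbol_mul {P : Space d → ℂ} (hPg : P.HasTemperateGrowth) {m : ℕ}
    (hP : ∀ r : ℝ, 0 < r → ∀ ξ, P (r • ξ) = (r : ℂ) ^ m * P ξ) {r : ℝ} (hr : 0 < r) :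
    Integrable fun ξ => heatSymbol (r ^ 2) ξ * P ξ := by
  obtain ⟨f, hf⟩ := exists_schwartz_eq_heatSymbol_mul hPg
  have h := f.integrable (μ := (volume : Measure (Space d)))
  rw [show (f : Space d → ℂ) = fun ξ => heatSymbol 1 ξ * P ξ from funext hf] at h
  simp_rw [heatSymbol_mul_eq_of_homogeneous hP hr]
  exact (h.comp_smul hr.ne').const_mul _

lemma integral_norm_heatSymbol_mul {P : Space d → ℂ} {m : ℕ}
    (hP : ∀ r : ℝ, 0 < r → ∀ ξ, P (r • ξ) = (r : ℂ) ^ m * P ξ) {r : ℝ} (hr : 0 < r) :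
    ∫ ξ, ‖heatSymbol (r ^ 2) ξ * P ξ‖ = (r ^ (d + m))⁻¹ * ∫ ξ, ‖heatSymbol 1 ξ * P ξ‖ := by
  simp_rw [heatSymbol_mul_eq_of_homogeneous hP hr]
  simp_rw [norm_mul ((((r ^ m)⁻¹ : ℝ)) : ℂ)]
  rw [integral_const_mul, Measure.integral_comp_smul_of_nonneg (volume : Measure (Space d))
    (fun ξ => ‖heatSymbol 1 ξ * P ξ‖) r (hR := hr.le), Complex.norm_real,
    Real.norm_of_nonneg (by positivity), finrank_euclideanSpace_fin, smul_eq_mul, pow_add]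
  rw [← mul_assoc]; congr 1; rw [mul_inv, mul_comm]

/-- Symbol of the third derivative `∂_j ∂_k ∂_l`. -/
def cubicSymbol (j k l : Fin d) (ξ : Space d) : ℂ :=
  -(4 * (Real.pi : ℂ) ^ 2) * ((ξ j : ℂ) * (ξ k : ℂ)) * derivSymbol l ξ

lemma hasTemperateGrowth_cubicSymbol (j k l : Fin d) :
    (cubicSymbol j k l : Space d → ℂ).HasTemperateGrowth :=
  ((Function.HasTemperateGrowth.const _).mul
    ((hasTemperateGrowth_coord j).mul (hasTemperateGrowth_coord k))).mul
    (hasTemperateGrowth_derivSymbol l)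

lemma cubicSymbol_smul (j k l : Fin d) (r : ℝ) (ξ : Space d) :
    cubicSymbol j k l (r • ξ) = (r : ℂ) ^ 3 * cubicSymbol j k l ξ := by
  simp only [cubicSymbol, derivSymbol_smul, PiLp.smul_apply, smul_eq_mul, Complex.ofReal_mul]
  ring

/-- The identity `-ξ_jξ_k/|ξ|² e^{-4π²|ξ|²} = -4π² ∫_1^∞ ξ_jξ_k e^{-4π²s|ξ|²} ds` turns the
singular part of the Leray symbol into a superposition of Gaussians. -/
lemma heatSymbol_mul_leraySymbol_mul_derivSymbol (j k l : Fin d) (ξ : Space d) :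
    heatSymbol 1 ξ * leraySymbol j k ξ * derivSymbol l ξ =
      (if j = k then 1 else 0) * (heatSymbol 1 ξ * derivSymbol l ξ) +
        ∫ s in Ioi (1 : ℝ), heatSymbol s ξ * cubicSymbol j k l ξ := by
  rcases eq_or_ne ξ 0 with rfl | hξ
  · simp [derivSymbol, cubicSymbol]
  have hn : 0 < ‖ξ‖ := norm_pos_iff.2 hξ
  have hn' : (‖ξ‖ : ℂ) ≠ 0 := by exact_mod_cast hn.ne'
  have hpi : (Real.pi : ℂ) ≠ 0 := by exact_mod_cast Real.pi_ne_zero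
  have h1 : ∫ s in Ioi (1 : ℝ), heatSymbol s ξ =
      heatSymbol 1 ξ / ((4 * Real.pi ^ 2 * ‖ξ‖ ^ 2 : ℝ) : ℂ) := by
    unfold heatSymbol
    rw [integral_complex_ofReal]
    have := integral_exp_mul_Ioi (a := -(4 * Real.pi ^ 2 * ‖ξ‖ ^ 2))
      (by simp only [Left.neg_neg_iff]; positivity) 1
    rw [show (fun s : ℝ => Real.exp (-(4 * Real.pi ^ 2 * s * ‖ξ‖ ^ 2))) =
      fun s => Real.exp (-(4 * Real.pi ^ 2 * ‖ξ‖ ^ 2) * s) by ext; ring_nf, this]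
    rw [neg_div_neg_eq]
    push_cast
    ring_nf
  rw [integral_mul_const, h1, leraySymbol, cubicSymbol, rieszSymbol, rieszSymbol]
  push_cast
  field_simp
  rw [Complex.I_sq]
  ring

lemma integrable_prod_heatSymbol_mul_cubicSymbol (j k l : Fin d) :
    Integrable (fun p : Space d × ℝ => heatSymbol p.2 p.1 * cubicSymbol j k l p.1)
      ((volume : Measure (Space d)).prod (volume.restrict (Ioi (1 : ℝ)))) := by
  have hm : Measurable fun p : Space d × ℝ => heatSymbol p.2 p.1 * cubicSymbol j k l p.1 :=
    (measurable_heatSymbol.comp (by fun_prop : Measurable fun p : Space d × ℝ => (p.2, p.1))).mul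
      ((hasTemperateGrowth_cubicSymbol j k l).1.continuous.measurable.comp measurable_fst)
  have hP := fun r (_ : 0 < r) ξ => cubicSymbol_smul j k l r ξ
  refine (integrable_prod_iff' hm.aestronglyMeasurable).2 ⟨?_, ?_⟩
  · refine (ae_restrict_iff' measurableSet_Ioi).2 (.of_forall fun s hs => ?_)
    have hs0 : (0 : ℝ) < s := lt_trans one_pos hs
    have := integrable_heatSymbol_mul (hasTemperateGrowth_cubicSymbol j k l) hP
      (Real.sqrt_pos.2 hs0)
    rwa [Real.sq_sqrt hs0.le] at this
  -- by scaling, the `L¹` norm of the symbol at time `s` is a multiple of `s^{-(d+3)/2}`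
  · have h1 : IntegrableOn (fun s : ℝ => s ^ (-((d : ℝ) + 3) / 2) *
        ∫ ξ, ‖heatSymbol 1 ξ * cubicSymbol j k l ξ‖) (Ioi 1) :=
      (integrableOn_Ioi_rpow_of_lt (by linarith [(Nat.cast_nonneg d : (0 : ℝ) ≤ d)])
        one_pos).mul_const _
    refine h1.congr_fun (fun s hs => ?_) measurableSet_Ioi
    have hs0 : (0 : ℝ) < s := lt_trans one_pos hs
    have := integral_norm_heatSymbol_mul hP (Real.sqrt_pos.2 hs0)
    rw [Real.sq_sqrt hs0.le] at this
    simp only [this]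
    congr 1
    rw [Real.sqrt_eq_rpow, ← Real.rpow_natCast, ← Real.rpow_mul hs0.le, ← Real.rpow_neg hs0.le]
    congr 1; push_cast; ring

/-- The kernel at time `1` as a derivative of the heat kernel plus a superposition of third
derivatives of heat kernels. -/
lemma fourierInv_leraySymbol_eq (j k l : Fin d) (x : Space d) :
    𝓕⁻ (fun ξ : Space d => heatSymbol 1 ξ * leraySymbol j k ξ * derivSymbol l ξ) x =
      (if j = k then 1 else 0) * 𝓕⁻ (fun ξ : Space d => heatSymbol 1 ξ * derivSymbol l ξ) x +
        ∫ s in Ioi (1 : ℝ), 𝓕⁻ (fun ξ => heatSymbol s ξ * cubicSymbol j k l ξ) x := by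
  have hint := integrable_prod_heatSymbol_mul_cubicSymbol j k l
  have he : Measurable fun v : Space d =>
      Complex.exp (((2 * Real.pi * inner ℝ v x : ℝ) : ℂ) * Complex.I) := by
    have : Measurable fun v : Space d => (inner ℝ v x : ℝ) :=
      (by fun_prop : Continuous fun v : Space d => (inner ℝ v x : ℝ)).measurable
    fun_prop
  have hb : ∀ v : Space d,
      ‖Complex.exp (((2 * Real.pi * inner ℝ v x : ℝ) : ℂ) * Complex.I)‖ ≤ 1 := fun v =>
    (Complex.norm_exp_ofReal_mul_I _).le
  have h1 : Integrable fun ξ : Space d => heatSymbol 1 ξ * derivSymbol l ξ := by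
    have := integrable_heatSymbol_mul (hasTemperateGrowth_derivSymbol l) (m := 1)
      (fun r _ ξ => by rw [derivSymbol_smul, pow_one]) one_pos
    simpa using this
  have h2 := hint.integral_prod_left
  simp_rw [Real.fourierInv_eq', heatSymbol_mul_leraySymbol_mul_derivSymbol, smul_eq_mul]
  have h3 : ∫ s in Ioi (1 : ℝ), ∫ v : Space d,
      Complex.exp (((2 * Real.pi * inner ℝ v x : ℝ) : ℂ) * Complex.I) *
        (heatSymbol s v * cubicSymbol j k l v) = ∫ v : Space d, ∫ s in Ioi (1 : ℝ),
      Complex.exp (((2 * Real.pi * inner ℝ v x : ℝ) : ℂ) * Complex.I) *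
        (heatSymbol s v * cubicSymbol j k l v) := by
    refine integral_integral_swap (hint.swap.bdd_mul (c := 1)
      (he.comp measurable_snd).aestronglyMeasurable (.of_forall fun p => hb p.2))
  rw [h3, ← integral_const_mul, ← integral_add]
  · congr 1; ext v
    rw [integral_const_mul]
    ring
  · exact (h1.bdd_mul (c := 1) he.aestronglyMeasurable (.of_forall hb)).const_mul _
  · simp_rw [integral_const_mul]
    exact h2.bdd_mul (c := 1) he.aestronglyMeasurable (.of_forall hb)

/-! ### Pointwise bound of the kernel of `e^{sΔ} ℙ ∇·` -/

/-- The function `min (R^{-d-2} s^{-1/2}) (s^{-(d+3)/2})` of `s > 0` has mass `O(R^{-d-1})`: the two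
terms cross at `s = R²`. -/
lemma exists_setIntegral_min_le (d : ℕ) : ∃ C : ℝ, 0 < C ∧ ∀ (F : ℝ → ℂ) (R : ℝ), 0 < R →
    (∀ s, 0 < s → ‖F s‖ ≤ s ^ (-((d : ℝ) + 3) / 2)) →
    (∀ s, 0 < s → R ^ (d + 2) * ‖F s‖ ≤ s ^ (-(1 / 2) : ℝ)) →
    R ^ (d + 1) * ‖∫ s in Ioi (1 : ℝ), F s‖ ≤ C := by
  refine ⟨2 + 2 / ((d : ℝ) + 1), by positivity, fun F R hR h1 h2 => ?_⟩
  have hR2 : 0 < R ^ 2 := by positivity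
  set b1 : ℝ → ℝ := (Ioc 0 (R ^ 2)).indicator fun s => (R ^ (d + 2))⁻¹ * s ^ (-(1 / 2) : ℝ)
  set b2 : ℝ → ℝ := (Ioi (R ^ 2)).indicator fun s => s ^ (-((d : ℝ) + 3) / 2)
  have hexp : -((d : ℝ) + 3) / 2 < -1 := by linarith [(Nat.cast_nonneg d : (0 : ℝ) ≤ d)]
  have i1 : Integrable b1 := by
    refine (integrable_indicator_iff measurableSet_Ioc).2 (Integrable.const_mul ?_ _)
    exact (intervalIntegrable_iff_integrableOn_Ioc_of_le hR2.le).1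
      (intervalIntegral.intervalIntegrable_rpow' (by norm_num))
  have i2 : Integrable b2 := (integrable_indicator_iff measurableSet_Ioi).2
    (integrableOn_Ioi_rpow_of_lt hexp hR2)
  have n1 : ∀ s, 0 ≤ b1 s := fun s => indicator_nonneg (fun s hs => by
    have := hs.1; positivity) s
  have n2 : ∀ s, 0 ≤ b2 s := fun s => indicator_nonneg (fun s hs => by
    have : 0 < s := hR2.trans hs
    positivity) s
  have hle : ‖∫ s in Ioi (1 : ℝ), F s‖ ≤ ∫ s in Ioi (1 : ℝ), (b1 s + b2 s) := by
    refine norm_integral_le_of_norm_le (i1.add i2).integrableOn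
      ((ae_restrict_iff' measurableSet_Ioi).2 (.of_forall fun s hs => ?_))
    have hs0 : 0 < s := one_pos.trans hs
    by_cases hsR : s ≤ R ^ 2
    · have : b1 s = (R ^ (d + 2))⁻¹ * s ^ (-(1 / 2) : ℝ) :=
        indicator_of_mem (s := Ioc 0 (R ^ 2)) ⟨hs0, hsR⟩ _
      rw [this]
      refine le_add_of_le_of_nonneg ?_ (n2 s)
      rw [inv_mul_eq_div, le_div_iff₀ (by positivity), mul_comm]
      exact h2 s hs0
    · have : b2 s = s ^ (-((d : ℝ) + 3) / 2) := indicator_of_mem (not_le.1 hsR) _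
      rw [this]
      exact le_add_of_nonneg_of_le (n1 s) (h1 s hs0)
  have hle2 : ∫ s in Ioi (1 : ℝ), (b1 s + b2 s) ≤ ∫ s, b1 s + b2 s :=
    setIntegral_le_integral (i1.add i2) (.of_forall fun s => add_nonneg (n1 s) (n2 s))
  have v1 : ∫ s, b1 s = 2 * (R ^ (d + 1))⁻¹ := by
    rw [integral_indicator measurableSet_Ioc, integral_const_mul,
      ← intervalIntegral.integral_of_le hR2.le, integral_rpow (Or.inl (by norm_num)),
      Real.zero_rpow (by norm_num), ← Real.rpow_natCast R 2, ← Real.rpow_mul hR.le]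
    norm_num
    field_simp
    ring
  have v2 : ∫ s, b2 s = 2 / ((d : ℝ) + 1) * (R ^ (d + 1))⁻¹ := by
    rw [integral_indicator measurableSet_Ioi, integral_Ioi_rpow_of_lt hexp hR2,
      ← Real.rpow_natCast R 2, ← Real.rpow_mul hR.le,
      show ((2 : ℕ) : ℝ) * (-((d : ℝ) + 3) / 2 + 1) = -((d + 1 : ℕ) : ℝ) by push_cast; ring,
      Real.rpow_neg hR.le, Real.rpow_natCast,
      show -((d : ℝ) + 3) / 2 + 1 = -((d + 1) / 2) by ring]
    have : (d : ℝ) + 1 ≠ 0 := by positivity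
    field_simp
  rw [integral_add i1 i2, v1, v2] at hle2
  calc R ^ (d + 1) * ‖∫ s in Ioi (1 : ℝ), F s‖
      ≤ R ^ (d + 1) * (2 * (R ^ (d + 1))⁻¹ + 2 / ((d : ℝ) + 1) * (R ^ (d + 1))⁻¹) := by
        gcongr; exact hle.trans hle2
    _ = _ := by field_simp

lemma sqrt_pow_inv_eq_rpow {s : ℝ} (hs : 0 < s) (n : ℕ) :
    (Real.sqrt s ^ n)⁻¹ = s ^ (-(n : ℝ) / 2) := by
  rw [Real.sqrt_eq_rpow, ← Real.rpow_natCast, ← Real.rpow_mul hs.le, ← Real.rpow_neg hs.le]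
  congr 1; ring

/-- Spatial decay of the kernel of `e^{Δ} ℙ ∇·`. -/
lemma exists_pow_mul_lerayHeatKernel_one_le (j k l : Fin d) : ∃ C : ℝ, ∀ x : Space d,
    ‖x‖ ^ (d + 1) * |lerayHeatKernel 1 j k l x| ≤ C := by
  have hq := hasTemperateGrowth_cubicSymbol j k l
  have hqs := fun r (_ : 0 < r) ξ => cubicSymbol_smul j k l r ξ
  obtain ⟨A, hA, h0⟩ := exists_pow_mul_norm_fourierInv_le hq hqs 0
  obtain ⟨B, hB, h2⟩ := exists_pow_mul_norm_fourierInv_le hq hqs (d + 2)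
  obtain ⟨D, hD, h1⟩ := exists_pow_mul_norm_fourierInv_le (hasTemperateGrowth_derivSymbol l)
    (m := 1) (fun r _ ξ => by rw [derivSymbol_smul, pow_one]) (d + 1)
  obtain ⟨C, hC, hmin⟩ := exists_setIntegral_min_le d
  refine ⟨D + (A + B) * C, fun x => ?_⟩
  rcases eq_or_ne x 0 with rfl | hx
  · simp only [norm_zero, zero_pow (Nat.succ_ne_zero d), zero_mul]; positivity
  have hx' : 0 < ‖x‖ := norm_pos_iff.2 hx
  have hAB : 0 < A + B := by positivity
  have key := hmin (fun s => ((A + B)⁻¹ : ℝ) *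
    𝓕⁻ (fun ξ => heatSymbol s ξ * cubicSymbol j k l ξ) x) ‖x‖ hx'
    (fun s hs => by
      have := h0 (Real.sqrt s) (Real.sqrt_pos.2 hs) x
      rw [Real.sq_sqrt hs.le, sqrt_pow_inv_eq_rpow hs, pow_zero, pow_zero, one_mul, mul_one] at this
      rw [norm_mul, Complex.norm_real, Real.norm_of_nonneg (by positivity), inv_mul_le_iff₀ hAB]
      refine this.trans ?_
      push_cast
      rw [neg_div]
      gcongr
      linarith)
    (fun s hs => by
      have := h2 (Real.sqrt s) (Real.sqrt_pos.2 hs) x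
      rw [Real.sq_sqrt hs.le, pow_succ (Real.sqrt s) (d + 2), mul_inv, mul_assoc,
        mul_inv_cancel_left₀ (pow_ne_zero _ (Real.sqrt_pos.2 hs).ne'), ← pow_one (Real.sqrt s),
        sqrt_pow_inv_eq_rpow hs] at this
      rw [norm_mul, Complex.norm_real, Real.norm_of_nonneg (by positivity), mul_left_comm,
        inv_mul_le_iff₀ hAB]
      refine this.trans ?_
      push_cast
      rw [neg_div]
      gcongr
      linarith)
  rw [integral_const_mul, norm_mul, Complex.norm_real, Real.norm_of_nonneg (by positivity),
    mul_left_comm, inv_mul_le_iff₀ hAB] at key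
  have h1' := h1 1 one_pos x
  simp only [one_pow, inv_one, mul_one] at h1'
  calc _ ≤ ‖x‖ ^ (d + 1) * ‖𝓕⁻ (fun ξ : Space d =>
          heatSymbol 1 ξ * leraySymbol j k ξ * derivSymbol l ξ) x‖ := by
        gcongr; exact Complex.abs_re_le_norm _
    _ ≤ ‖x‖ ^ (d + 1) * (‖𝓕⁻ (fun ξ : Space d => heatSymbol 1 ξ * derivSymbol l ξ) x‖ +
          ‖∫ s in Ioi (1 : ℝ), 𝓕⁻ (fun ξ => heatSymbol s ξ * cubicSymbol j k l ξ) x‖) := by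
        rw [fourierInv_leraySymbol_eq]
        gcongr
        refine (norm_add_le _ _).trans ?_
        gcongr
        rw [norm_mul]
        refine mul_le_of_le_one_left (norm_nonneg _) ?_
        split_ifs <;> simp
    _ ≤ _ := by rw [mul_add]; gcongr

lemma exists_lerayHeatKernel_one_le (j k l : Fin d) : ∃ C : ℝ, ∀ x : Space d,
    |lerayHeatKernel 1 j k l x| ≤ C := by
  refine ⟨∫ ξ : Space d, ‖heatSymbol 1 ξ * leraySymbol j k ξ * derivSymbol l ξ‖, fun x => ?_⟩
  exact (Complex.abs_re_le_norm _).trans (norm_fourierInv_le _ x)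

lemma lerayHeatKernel_scaling (j k l : Fin d) {r : ℝ} (hr : 0 < r) (x : Space d) :
    lerayHeatKernel (r ^ 2) j k l x = (r ^ (d + 1))⁻¹ * lerayHeatKernel 1 j k l (r⁻¹ • x) := by
  have := fourierInv_heatSymbol_mul_of_homogeneous (m := 1)
    (P := fun ξ : Space d => leraySymbol j k ξ * derivSymbol l ξ)
    (fun r hr ξ => by rw [leraySymbol_smul j k hr, derivSymbol_smul, pow_one]; ring) hr x
  simp_rw [← mul_assoc] at this
  rw [lerayHeatKernel, lerayHeatKernel, this, Complex.re_ofReal_mul]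

/-- Pointwise bound of the kernel of `e^{sΔ} ℙ ∇·`: it is dominated by
`(|x| + √s)^{-(d+1)}`. -/
theorem exists_lerayHeatKernel_le (d : ℕ) : ∃ C : ℝ, 0 < C ∧ ∀ (j k l : Fin d) (s : ℝ), 0 < s →
    ∀ x : Space d, |lerayHeatKernel s j k l x| ≤ C * ((‖x‖ + Real.sqrt s) ^ (d + 1))⁻¹ := by
  choose A hA using fun j k l : Fin d => exists_lerayHeatKernel_one_le j k l
  choose B hB using fun j k l : Fin d => exists_pow_mul_lerayHeatKernel_one_le j k l
  set C0 : ℝ := ∑ j, ∑ k, ∑ l, (|A j k l| + |B j k l|)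
  have hAB : ∀ j k l, |A j k l| + |B j k l| ≤ C0 := fun j k l => by
    refine le_trans ?_ (Finset.single_le_sum (f := fun j => ∑ k, ∑ l, (|A j k l| + |B j k l|))
      (fun _ _ => by positivity) (Finset.mem_univ j))
    refine le_trans ?_ (Finset.single_le_sum (f := fun k => ∑ l, (|A j k l| + |B j k l|))
      (fun _ _ => by positivity) (Finset.mem_univ k))
    exact Finset.single_le_sum (f := fun l => (|A j k l| + |B j k l|))
      (fun _ _ => by positivity) (Finset.mem_univ l)
  have hC0 : 0 ≤ C0 := by positivity
  refine ⟨2 ^ d * C0 + 1, by positivity, fun j k l s hs x => ?_⟩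
  have hr : 0 < Real.sqrt s := Real.sqrt_pos.2 hs
  set r := Real.sqrt s
  have hs' : s = r ^ 2 := (Real.sq_sqrt hs.le).symm
  set K := |lerayHeatKernel 1 j k l (r⁻¹ • x)|
  have hn : ‖r⁻¹ • x‖ = ‖x‖ / r := by
    rw [norm_smul, norm_inv, Real.norm_of_nonneg hr.le, inv_mul_eq_div]
  have h1 : (‖r⁻¹ • x‖ + 1) ^ (d + 1) * K ≤ 2 ^ d * C0 := by
    calc (‖r⁻¹ • x‖ + 1) ^ (d + 1) * K
        ≤ 2 ^ d * (‖r⁻¹ • x‖ ^ (d + 1) + 1 ^ (d + 1)) * K := by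
          gcongr
          exact add_pow_le (norm_nonneg _) zero_le_one (d + 1)
      _ = 2 ^ d * (K + ‖r⁻¹ • x‖ ^ (d + 1) * K) := by rw [one_pow]; ring
      _ ≤ 2 ^ d * (|A j k l| + |B j k l|) := by
          gcongr
          · exact (hA j k l _).trans (le_abs_self _)
          · exact (hB j k l _).trans (le_abs_self _)
      _ ≤ _ := by gcongr; exact hAB j k l
  have h2 : (‖x‖ + r) ^ (d + 1) = (‖r⁻¹ • x‖ + 1) ^ (d + 1) * r ^ (d + 1) := by
    rw [hn, ← mul_pow, add_mul, div_mul_cancel₀ _ hr.ne', one_mul]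
  have h3 : |lerayHeatKernel s j k l x| = (r ^ (d + 1))⁻¹ * K := by
    rw [hs', lerayHeatKernel_scaling j k l hr, abs_mul, abs_of_nonneg (by positivity)]
  rw [h3, h2, ← div_eq_mul_inv, le_div_iff₀ (by positivity)]
  calc _ = (‖r⁻¹ • x‖ + 1) ^ (d + 1) * K := by field_simp
    _ ≤ _ := by linarith

/-! ### Power weights in space and time -/

lemma integrable_add_norm_pow_inv (σ : ℝ) (hσ : 0 < σ) :
    Integrable (fun z : Space d => ((‖z‖ + σ) ^ (d + 1))⁻¹) ∧
    ∫ z : Space d, ((‖z‖ + σ) ^ (d + 1))⁻¹ = σ⁻¹ * ∫ z : Space d, ((‖z‖ + 1) ^ (d + 1))⁻¹ := by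
  have h1 : Integrable (fun z : Space d => ((‖z‖ + 1) ^ (d + 1))⁻¹) := by
    have := integrable_one_add_norm (μ := (volume : Measure (Space d))) (r := d + 1) (by simp)
    refine this.congr (.of_forall fun z => ?_)
    simp only
    rw [Real.rpow_neg (by positivity), add_comm, ← Real.rpow_natCast]
    push_cast; rfl
  have hs : ∀ z : Space d, ((‖z‖ + σ) ^ (d + 1))⁻¹ =
      (σ ^ (d + 1))⁻¹ * ((‖σ⁻¹ • z‖ + 1) ^ (d + 1))⁻¹ := fun z => by
    rw [norm_smul, norm_inv, Real.norm_of_nonneg hσ.le, ← mul_inv, ← mul_pow]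
    congr 2; field_simp
  simp_rw [hs]
  refine ⟨(h1.comp_smul (inv_ne_zero hσ.ne')).const_mul _, ?_⟩
  rw [integral_const_mul, Measure.integral_comp_smul_of_nonneg (volume : Measure (Space d))
    (fun z => ((‖z‖ + 1) ^ (d + 1))⁻¹) σ⁻¹ (hR := by positivity), finrank_euclideanSpace_fin,
    smul_eq_mul, ← mul_assoc]
  congr 1
  rw [inv_pow, inv_inv, pow_succ]; field_simp

lemma integrable_indicator_norm_rpow {γ : ℝ} (hd : 1 ≤ d) (hγ : γ < d) (ρ : ℝ) (hρ : 0 < ρ) :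
    Integrable ((Metric.ball (0 : Space d) ρ).indicator fun y => ‖y‖ ^ (-γ)) ∧
    ∫ y, (Metric.ball (0 : Space d) ρ).indicator (fun y => ‖y‖ ^ (-γ)) y =
      ρ ^ ((d : ℝ) - γ) * ∫ y, (Metric.ball (0 : Space d) 1).indicator (fun y => ‖y‖ ^ (-γ)) y := by
  constructor
  · rw [integrable_indicator_iff measurableSet_ball]
    refine integrableOn_ball_of_norm_le_rpow (C := 1) (α := γ) (by simpa using hd)
      (by simpa using hγ) (.of_forall fun y => ?_) (Measurable.aestronglyMeasurable (by fun_prop))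
    rw [one_mul, Real.norm_of_nonneg (by positivity)]
  · have h : ∀ y : Space d, (Metric.ball (0 : Space d) ρ).indicator (fun y => ‖y‖ ^ (-γ)) y =
        ρ ^ (-γ) * (Metric.ball (0 : Space d) 1).indicator (fun y => ‖y‖ ^ (-γ)) (ρ⁻¹ • y) :=
        fun y => by
      have hn : ‖ρ⁻¹ • y‖ = ρ⁻¹ * ‖y‖ := by
        rw [norm_smul, norm_inv, Real.norm_of_nonneg hρ.le]
      have hm : ρ⁻¹ • y ∈ Metric.ball (0 : Space d) 1 ↔ y ∈ Metric.ball (0 : Space d) ρ := by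
        rw [mem_ball_zero_iff, mem_ball_zero_iff, hn, inv_mul_lt_one₀ hρ]
      by_cases hy : y ∈ Metric.ball (0 : Space d) ρ
      · rw [indicator_of_mem hy, indicator_of_mem (hm.2 hy), hn,
          Real.mul_rpow (by positivity) (norm_nonneg _), ← mul_assoc, Real.inv_rpow hρ.le,
          mul_inv_cancel₀ (by positivity), one_mul]
      · rw [indicator_of_notMem hy, indicator_of_notMem (hm.not.2 hy), mul_zero]
    simp_rw [h]
    rw [integral_const_mul, Measure.integral_comp_smul_of_nonneg (volume : Measure (Space d))
      _ ρ⁻¹ (hR := by positivity), finrank_euclideanSpace_fin, smul_eq_mul, ← mul_assoc]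
    congr 1
    rw [inv_pow, inv_inv, ← Real.rpow_natCast, ← Real.rpow_add hρ]
    ring_nf

/-- Convolution of a power weight with the envelope `(|z| + σ)^{-(d+1)}` of the kernel. At the origin
the weight `‖y‖ ^ (-γ)` takes the value `0` for `γ > 0`, which does not affect the integral. -/
theorem exists_integral_convolution_rpow_le (hd : 1 ≤ d) {γ : ℝ} (hγ0 : 0 ≤ γ) (hγ : γ < d) :
    ∃ C : ℝ, 0 < C ∧ ∀ (x : Space d) (σ : ℝ), 0 < σ →
      Integrable (fun y : Space d => ((‖x - y‖ + σ) ^ (d + 1))⁻¹ * ‖y‖ ^ (-γ)) ∧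
      ∫ y : Space d, ((‖x - y‖ + σ) ^ (d + 1))⁻¹ * ‖y‖ ^ (-γ) ≤
        C * (σ⁻¹ * (‖x‖ + σ) ^ (-γ)) := by
  set A := ∫ z : Space d, ((‖z‖ + 1) ^ (d + 1))⁻¹
  set B := ∫ y, (Metric.ball (0 : Space d) 1).indicator (fun y => ‖y‖ ^ (-γ)) y
  have hA : 0 ≤ A := integral_nonneg fun z => by positivity
  have hB : 0 ≤ B := integral_nonneg fun z => indicator_nonneg (fun y _ => by positivity) z
  refine ⟨4 ^ γ * A + 4 ^ (d + 1) * B + 1, by positivity, fun x σ hσ => ?_⟩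
  set R := ‖x‖ + σ with hRdef
  have hR : 0 < R := by positivity
  obtain ⟨i1, v1⟩ := integrable_add_norm_pow_inv (d := d) σ hσ
  obtain ⟨i2, v2⟩ := integrable_indicator_norm_rpow hd hγ (R / 4) (by positivity)
  replace i1 : Integrable (fun y : Space d => ((‖x - y‖ + σ) ^ (d + 1))⁻¹) := i1.comp_sub_left x
  have v1' : ∫ y : Space d, ((‖x - y‖ + σ) ^ (d + 1))⁻¹ = σ⁻¹ * A := by
    rw [← v1, integral_sub_left_eq_self (fun z : Space d => ((‖z‖ + σ) ^ (d + 1))⁻¹) volume x]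
  set g : Space d → ℝ := fun y => (R / 4) ^ (-γ) * ((‖x - y‖ + σ) ^ (d + 1))⁻¹ +
    ((R / 4) ^ (d + 1))⁻¹ * (Metric.ball (0 : Space d) (R / 4)).indicator (fun y => ‖y‖ ^ (-γ)) y
  have ig : Integrable g := (i1.const_mul _).add (i2.const_mul _)
  -- for `|y| < R/4` the kernel is at most `(R/4)^{-(d+1)}`, otherwise the weight is at most
  -- `(R/4)^{-γ}`
  have hle : ∀ y : Space d, ((‖x - y‖ + σ) ^ (d + 1))⁻¹ * ‖y‖ ^ (-γ) ≤ g y := fun y => by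
    by_cases hy : y ∈ Metric.ball (0 : Space d) (R / 4)
    · have hy' : ‖y‖ < R / 4 := mem_ball_zero_iff.1 hy
      have : R / 4 ≤ ‖x - y‖ + σ := by
        have := norm_sub_norm_le x y
        linarith
      simp only [g, indicator_of_mem hy]
      refine le_add_of_nonneg_of_le (by positivity) ?_
      gcongr
    · have hy' : R / 4 ≤ ‖y‖ := by simpa using hy
      simp only [g, indicator_of_notMem hy, mul_zero, add_zero]
      rw [mul_comm]
      gcongr ?_ * _
      exact Real.rpow_le_rpow_of_nonpos (by positivity) hy' (by linarith)
  have i3 : Integrable (fun y : Space d => ((‖x - y‖ + σ) ^ (d + 1))⁻¹ * ‖y‖ ^ (-γ)) :=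
    ig.mono' (Measurable.aestronglyMeasurable (by fun_prop)) (.of_forall fun y => by
      rw [Real.norm_of_nonneg (by positivity)]; exact hle y)
  refine ⟨i3, (integral_mono i3 ig hle).trans ?_⟩
  have hval : ∫ y, g y = 4 ^ γ * A * (σ⁻¹ * R ^ (-γ)) +
      4 ^ (d + 1) * B * ((R / 4) ^ ((d : ℝ) - γ) * (R ^ (d + 1))⁻¹) := by
    rw [integral_add (i1.const_mul _) (i2.const_mul _), integral_const_mul, integral_const_mul,
      v1', v2, Real.div_rpow hR.le (by norm_num), Real.rpow_neg (by norm_num : (0 : ℝ) ≤ 4), div_pow]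
    field_simp
    ring
  have h4 : (R / 4) ^ ((d : ℝ) - γ) * (R ^ (d + 1))⁻¹ ≤ σ⁻¹ * R ^ (-γ) := by
    calc (R / 4) ^ ((d : ℝ) - γ) * (R ^ (d + 1))⁻¹
        ≤ R ^ ((d : ℝ) - γ) * (R ^ (d + 1))⁻¹ := by
          gcongr
          · linarith
      _ = R⁻¹ * R ^ (-γ) := by
          rw [← Real.rpow_natCast, ← Real.rpow_neg hR.le, ← Real.rpow_add hR,
            ← Real.rpow_neg_one, ← Real.rpow_add hR]
          push_cast; ring_nf
      _ ≤ σ⁻¹ * R ^ (-γ) := by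
          gcongr
          linarith [norm_nonneg x]
  rw [hval]
  have : 0 ≤ σ⁻¹ * R ^ (-γ) := by positivity
  calc _ ≤ 4 ^ γ * A * (σ⁻¹ * R ^ (-γ)) + 4 ^ (d + 1) * B * (σ⁻¹ * R ^ (-γ)) := by gcongr
    _ ≤ _ := by linarith

/-- The Beta integral `∫_0^t (t-τ)^{-p} τ^{-q} dτ = O(t^{1-p-q})`. -/
theorem exists_integral_rpow_mul_rpow_le {p q : ℝ} (hp0 : 0 ≤ p) (hp : p < 1) (hq0 : 0 ≤ q)
    (hq : q < 1) : ∃ C : ℝ, 0 < C ∧ ∀ t : ℝ, 0 < t →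
      IntegrableOn (fun τ => (t - τ) ^ (-p) * τ ^ (-q)) (Ioo 0 t) ∧
      ∫ τ in Ioo 0 t, (t - τ) ^ (-p) * τ ^ (-q) ≤ C * t ^ (1 - p - q) := by
  refine ⟨2 ^ p / (1 - q) + 2 ^ q / (1 - p),
    add_pos (div_pos (by positivity) (by linarith)) (div_pos (by positivity) (by linarith)),
    fun t ht => ?_⟩
  have J : ∀ {q : ℝ}, q < 1 → IntervalIntegrable (fun τ : ℝ => τ ^ (-q)) volume 0 t ∧
      ∫ τ in (0 : ℝ)..t, τ ^ (-q) = t ^ (1 - q) / (1 - q) := fun {q} hq => by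
    refine ⟨intervalIntegral.intervalIntegrable_rpow' (by linarith), ?_⟩
    rw [integral_rpow (Or.inl (by linarith)), Real.zero_rpow (by linarith)]
    ring_nf
  obtain ⟨iq, vq⟩ := J hq
  obtain ⟨ip, vp⟩ := J hp
  replace ip : IntervalIntegrable (fun τ : ℝ => (t - τ) ^ (-p)) volume 0 t := by
    simpa using (ip.comp_sub_left t).symm
  replace vp : ∫ τ in (0 : ℝ)..t, (t - τ) ^ (-p) = t ^ (1 - p) / (1 - p) := by
    rw [← vp, intervalIntegral.integral_comp_sub_left (fun τ => τ ^ (-p)) t]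
    simp
  set g : ℝ → ℝ := fun τ => (t / 2) ^ (-p) * τ ^ (-q) + (t / 2) ^ (-q) * (t - τ) ^ (-p)
  have ig : IntervalIntegrable g volume 0 t := (iq.const_mul _).add (ip.const_mul _)
  have igo : IntegrableOn g (Ioo 0 t) :=
    ((intervalIntegrable_iff_integrableOn_Ioo_of_le ht.le).1 ig)
  -- on each half of `(0, t)` one of the two factors is bounded
  have hle : ∀ τ ∈ Ioo 0 t, (t - τ) ^ (-p) * τ ^ (-q) ≤ g τ := fun τ hτ => by
    have h1 : 0 < t - τ := by linarith [hτ.2]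
    have h2 : 0 < τ := hτ.1
    rcases le_total τ (t / 2) with h | h
    · refine le_add_of_le_of_nonneg ?_ (by positivity)
      gcongr ?_ * _
      exact Real.rpow_le_rpow_of_nonpos (by positivity) (by linarith) (by linarith)
    · refine le_add_of_nonneg_of_le (by positivity) ?_
      rw [mul_comm]
      gcongr ?_ * _
      exact Real.rpow_le_rpow_of_nonpos (by positivity) (by linarith) (by linarith)
  have i : IntegrableOn (fun τ => (t - τ) ^ (-p) * τ ^ (-q)) (Ioo 0 t) := by
    refine Integrable.mono' igo (Measurable.aestronglyMeasurable (by fun_prop))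
      ((ae_restrict_iff' measurableSet_Ioo).2 (.of_forall fun τ hτ => ?_))
    have h1 : 0 < t - τ := by linarith [hτ.2]
    have h2 : 0 < τ := hτ.1
    rw [Real.norm_of_nonneg (by positivity)]
    exact hle τ hτ
  refine ⟨i, (setIntegral_mono_on i igo measurableSet_Ioo hle).trans_eq ?_⟩
  rw [← integral_Ioc_eq_integral_Ioo, ← intervalIntegral.integral_of_le ht.le,
    intervalIntegral.integral_add (iq.const_mul _) (ip.const_mul _),
    intervalIntegral.integral_const_mul, intervalIntegral.integral_const_mul, vq, vp,
    Real.div_rpow ht.le (by norm_num), Real.div_rpow ht.le (by norm_num),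
    show 1 - p - q = -p + (1 - q) by ring, Real.rpow_add ht,
    Real.rpow_neg (by norm_num : (0 : ℝ) ≤ 2), Real.rpow_neg (by norm_num : (0 : ℝ) ≤ 2)]
  have e : t ^ (-q) * t ^ (1 - p) = t ^ (-p) * t ^ (1 - q) := by
    rw [← Real.rpow_add ht, ← Real.rpow_add ht]; ring_nf
  calc _ = t ^ (-p) * t ^ (1 - q) * (2 ^ p / (1 - q)) +
        t ^ (-q) * t ^ (1 - p) * (2 ^ q / (1 - p)) := by simp only [div_eq_mul_inv, inv_inv]; ring
    _ = _ := by rw [e]; ring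

/-! ### The Duhamel operator -/

lemma volume_restrict_prod_univ (S : Set ℝ) :
    (volume : Measure (ℝ × Space d)).restrict (S ×ˢ univ) =
      (volume.restrict S).prod (volume : Measure (Space d)) := by
  rw [Measure.volume_eq_prod, ← Measure.prod_restrict, Measure.restrict_univ]

lemma ae_snd_ne_zero (hd : 1 ≤ d) :
    ∀ᵐ p : ℝ × Space d, p.2 ≠ 0 := by
  have : Nonempty (Fin d) := ⟨⟨0, hd⟩⟩
  rw [Measure.volume_eq_prod]
  refine measure_mono_null (t := univ ×ˢ {(0 : Space d)}) (fun p hp => ?_) ?_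
  · simpa using hp
  · rw [Measure.prod_prod, measure_singleton, mul_zero]

/-- Space-time convolution with the kernel of `e^{sΔ} ℙ ∇·` of a density dominated by
`|y|^{-γ} h(τ)`. The time factor `h` and the majorant `φ` of the resulting time integrand are left
free, since both power weights and exponential weights are used. -/
theorem exists_integral_lerayHeatKernel_mul_le (hd : 1 ≤ d) {γ : ℝ} (hγ0 : 0 ≤ γ) (hγ : γ < d) :
    ∃ C : ℝ, 0 < C ∧ ∀ (j k l : Fin d) (f : ℝ × Space d → ℝ) (h φ : ℝ → ℝ) (M t : ℝ) (x : Space d),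
      Measurable f → Measurable h → 0 ≤ M → (∀ τ ∈ Ioo 0 t, 0 ≤ h τ) →
      (∀ τ ∈ Ioo 0 t, ∀ y : Space d, y ≠ 0 → |f (τ, y)| ≤ M * (‖y‖ ^ (-γ) * h τ)) →
      IntegrableOn φ (Ioo 0 t) →
      (∀ τ ∈ Ioo 0 t,
        (Real.sqrt (t - τ))⁻¹ * (‖x‖ + Real.sqrt (t - τ)) ^ (-γ) * h τ ≤ φ τ) →
      IntegrableOn (fun p : ℝ × Space d => lerayHeatKernel (t - p.1) j k l (x - p.2) * f p)
        (Ioo 0 t ×ˢ univ) ∧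
      |∫ p in Ioo 0 t ×ˢ (univ : Set (Space d)),
        lerayHeatKernel (t - p.1) j k l (x - p.2) * f p| ≤ C * M * ∫ τ in Ioo 0 t, φ τ := by
  obtain ⟨A, hA, hK⟩ := exists_lerayHeatKernel_le d
  obtain ⟨B, hB, hS⟩ := exists_integral_convolution_rpow_le hd hγ0 hγ
  refine ⟨A * B, by positivity, fun j k l f h φ M t x hf hh hM hh0 hfb hφ hle => ?_⟩
  have hσ : ∀ τ ∈ Ioo 0 t, 0 < Real.sqrt (t - τ) := fun τ hτ =>
    Real.sqrt_pos.2 (by linarith [hτ.2])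
  set G : ℝ × Space d → ℝ := fun p => A * M * h p.1 *
    (((‖x - p.2‖ + Real.sqrt (t - p.1)) ^ (d + 1))⁻¹ * ‖p.2‖ ^ (-γ)) with hG
  have mG : Measurable G := by fun_prop
  have G0 : ∀ τ ∈ Ioo 0 t, ∀ y, 0 ≤ G (τ, y) := fun τ hτ y => by
    have := hh0 τ hτ
    simp only [hG]; positivity
  have hGint : ∀ τ ∈ Ioo 0 t, ∫ y, G (τ, y) ≤ A * B * M * φ τ := fun τ hτ => by
    simp only [hG]
    rw [integral_const_mul]
    have := hh0 τ hτ
    calc _ ≤ A * M * h τ * (B * ((Real.sqrt (t - τ))⁻¹ * (‖x‖ + Real.sqrt (t - τ)) ^ (-γ))) := by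
          gcongr; exact (hS x _ (hσ τ hτ)).2
      _ = A * B * M * ((Real.sqrt (t - τ))⁻¹ * (‖x‖ + Real.sqrt (t - τ)) ^ (-γ) * h τ) := by ring
      _ ≤ _ := by gcongr; exact hle τ hτ
  have iG : Integrable G ((volume.restrict (Ioo 0 t)).prod volume) := by
    refine (integrable_prod_iff mG.aestronglyMeasurable).2 ⟨?_, ?_⟩
    · refine (ae_restrict_iff' measurableSet_Ioo).2 (.of_forall fun τ hτ => ?_)
      exact (hS x _ (hσ τ hτ)).1.const_mul (A * M * h τ)
    · refine Integrable.mono' (hφ.const_mul (A * B * M))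
        mG.norm.aestronglyMeasurable.integral_prod_right'
        ((ae_restrict_iff' measurableSet_Ioo).2 (.of_forall fun τ hτ => ?_))
      rw [Real.norm_of_nonneg (integral_nonneg fun y => norm_nonneg _)]
      simp_rw [Real.norm_of_nonneg (G0 τ hτ _)]
      exact hGint τ hτ
  have iG' : IntegrableOn G (Ioo 0 t ×ˢ univ) := by rwa [IntegrableOn, volume_restrict_prod_univ]
  have hbd : ∀ᵐ p ∂(volume : Measure (ℝ × Space d)).restrict (Ioo 0 t ×ˢ univ),
      ‖lerayHeatKernel (t - p.1) j k l (x - p.2) * f p‖ ≤ G p := by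
    refine (ae_restrict_iff' (measurableSet_Ioo.prod MeasurableSet.univ)).2 ?_
    filter_upwards [ae_snd_ne_zero hd] with p hp hpt
    have hτ := hpt.1
    rw [norm_mul]
    calc _ ≤ (A * ((‖x - p.2‖ + Real.sqrt (t - p.1)) ^ (d + 1))⁻¹) *
          (M * (‖p.2‖ ^ (-γ) * h p.1)) := by
          gcongr
          · exact hK j k l _ (by linarith [hτ.2]) _
          · exact hfb p.1 hτ p.2 hp
      _ = G p := by simp only [hG]; ring
  have mK : Measurable fun p : ℝ × Space d =>
      lerayHeatKernel (t - p.1) j k l (x - p.2) * f p :=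
    ((measurable_lerayHeatKernel j k l).comp
      (by fun_prop : Measurable fun p : ℝ × Space d => (t - p.1, x - p.2))).mul hf
  refine ⟨iG'.mono' mK.aestronglyMeasurable hbd, ?_⟩
  refine (norm_integral_le_of_norm_le iG' hbd).trans ?_
  rw [volume_restrict_prod_univ, integral_prod _ iG, ← integral_const_mul]
  exact setIntegral_mono_on iG.integral_prod_left (hφ.const_mul _) measurableSet_Ioo hGint

/-- The Duhamel integral `∫_0^t e^{(t-τ)Δ} ℙ ∇·F(τ) dτ`, written as an integral over
space-time. -/
def duhamel (F : ℝ → Space d → Matrix (Fin d) (Fin d) ℝ) (t : ℝ) (x : Space d) : Space d :=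
  WithLp.toLp 2 fun j => ∑ k, ∑ l, ∫ p in Ioo 0 t ×ˢ (univ : Set (Space d)),
    lerayHeatKernel (t - p.1) j k l (x - p.2) * F p.1 p.2 k l

/-- Absolute convergence of the Duhamel integral at `(t, x)`. -/
def DuhamelIntegrable (F : ℝ → Space d → Matrix (Fin d) (Fin d) ℝ) (t : ℝ) (x : Space d) : Prop :=
  ∀ j k l : Fin d, IntegrableOn (fun p : ℝ × Space d =>
    lerayHeatKernel (t - p.1) j k l (x - p.2) * F p.1 p.2 k l) (Ioo 0 t ×ˢ univ)

lemma norm_le_sum_abs (v : Space d) : ‖v‖ ≤ ∑ j, |v j| := by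
  conv_lhs => rw [← (EuclideanSpace.basisFun (Fin d) ℝ).sum_repr v]
  refine (norm_sum_le _ _).trans (Finset.sum_le_sum fun j _ => ?_)
  rw [norm_smul, OrthonormalBasis.norm_eq_one, mul_one]
  simp

lemma abs_sum_sum_le {f : Fin d → Fin d → ℝ} {B : ℝ} (h : ∀ k l, |f k l| ≤ B) :
    |∑ k, ∑ l, f k l| ≤ (d : ℝ) ^ 2 * B := by
  calc |∑ k, ∑ l, f k l| ≤ ∑ _k : Fin d, ∑ _l : Fin d, B :=
        (Finset.abs_sum_le_sum_abs _ _).trans (Finset.sum_le_sum fun k _ =>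
          (Finset.abs_sum_le_sum_abs _ _).trans (Finset.sum_le_sum fun l _ => h k l))
    _ = (d : ℝ) ^ 2 * B := by simp; ring

lemma norm_duhamel_le {F : ℝ → Space d → Matrix (Fin d) (Fin d) ℝ} {t : ℝ} {x : Space d} {B : ℝ}
    (h : ∀ j k l : Fin d, |∫ p in Ioo 0 t ×ˢ (univ : Set (Space d)),
      lerayHeatKernel (t - p.1) j k l (x - p.2) * F p.1 p.2 k l| ≤ B) :
    ‖duhamel F t x‖ ≤ (d : ℝ) ^ 3 * B := by
  refine (norm_le_sum_abs _).trans ?_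
  have : ∀ j, |duhamel F t x j| ≤ (d : ℝ) ^ 2 * B := fun j => by
    exact abs_sum_sum_le (h j)
  refine (Finset.sum_le_sum fun j _ => this j).trans_eq ?_
  simp; ring

lemma duhamel_sub {F G : ℝ → Space d → Matrix (Fin d) (Fin d) ℝ} {t : ℝ} {x : Space d}
    (hF : DuhamelIntegrable F t x) (hG : DuhamelIntegrable G t x) :
    duhamel (fun τ y => F τ y - G τ y) t x = duhamel F t x - duhamel G t x := by
  ext j
  simp only [duhamel, PiLp.sub_apply, ← Finset.sum_sub_distrib]
  refine Finset.sum_congr rfl fun k _ => Finset.sum_congr rfl fun l _ => ?_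
  rw [← integral_sub (hF j k l) (hG j k l)]
  simp only [Matrix.sub_apply, mul_sub]

lemma measurable_duhamel {F : ℝ → Space d → Matrix (Fin d) (Fin d) ℝ}
    (hF : ∀ k l, Measurable fun p : ℝ × Space d => F p.1 p.2 k l) :
    Measurable fun p : ℝ × Space d => duhamel F p.1 p.2 := by
  refine (WithLp.measurable_toLp 2 _).comp (measurable_pi_lambda _ fun j =>
    Finset.measurable_fun_sum _ fun k _ => Finset.measurable_fun_sum _ fun l _ => ?_)
  have hset : MeasurableSet {q : (ℝ × Space d) × (ℝ × Space d) | q.2.1 ∈ Ioo 0 q.1.1} := by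
    simp only [mem_Ioo, measurableSet_setOfPred]
    fun_prop
  have hm : Measurable ({q : (ℝ × Space d) × (ℝ × Space d) | q.2.1 ∈ Ioo 0 q.1.1}.indicator
      fun q => lerayHeatKernel (q.1.1 - q.2.1) j k l (q.1.2 - q.2.2) * F q.2.1 q.2.2 k l) := by
    refine Measurable.indicator ?_ hset
    exact ((measurable_lerayHeatKernel j k l).comp (by fun_prop :
      Measurable fun q : (ℝ × Space d) × (ℝ × Space d) => (q.1.1 - q.2.1, q.1.2 - q.2.2))).mul
      ((hF k l).comp measurable_snd)
  have := hm.stronglyMeasurable.integral_prod_right' (ν := (volume : Measure (ℝ × Space d)))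
  convert this.measurable using 2 with p
  rw [← integral_indicator (measurableSet_Ioo.prod MeasurableSet.univ)]
  congr 1; ext q
  simp only [indicator, mem_ofPred_eq, mem_prod, mem_univ, and_true]

/-- Fubini's theorem for the Duhamel integral. -/
lemma duhamel_eq_intervalIntegral {F : ℝ → Space d → Matrix (Fin d) (Fin d) ℝ} {t : ℝ} (ht : 0 < t)
    {x : Space d} (hF : DuhamelIntegrable F t x) :
    duhamel F t x = ∫ τ in (0 : ℝ)..t, lerayHeatDiv (t - τ) (F τ) x := by
  have hF' : ∀ j k l : Fin d, Integrable (fun p : ℝ × Space d =>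
      lerayHeatKernel (t - p.1) j k l (x - p.2) * F p.1 p.2 k l)
      ((volume.restrict (Ioo 0 t)).prod volume) := fun j k l => by
    rw [← volume_restrict_prod_univ]; exact hF j k l
  have hi : ∀ j : Fin d, Integrable (fun τ => lerayHeatDiv (t - τ) (F τ) x j)
      (volume.restrict (Ioo 0 t)) := fun j => by
    simp only [lerayHeatDiv]
    exact integrable_finsetSum _ fun k _ => integrable_finsetSum _ fun l _ =>
      (hF' j k l).integral_prod_left
  have hI : Integrable (fun τ => lerayHeatDiv (t - τ) (F τ) x) (volume.restrict (Ioo 0 t)) := by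
    refine ((PiLp.continuousLinearEquiv 2 ℝ (fun _ : Fin d => ℝ)).integrable_comp_iff).1 ?_
    exact Integrable.of_eval hi
  ext j
  rw [intervalIntegral.integral_of_le ht.le, integral_Ioc_eq_integral_Ioo]
  have h1 := (EuclideanSpace.proj (𝕜 := ℝ) j).integral_comp_comm hI
  simp only [EuclideanSpace.coe_proj] at h1
  rw [← h1]
  simp only [lerayHeatDiv, duhamel]
  rw [integral_finsetSum _ fun k _ => integrable_finsetSum _ fun l _ =>
      (hF' j k l).integral_prod_left]
  refine Finset.sum_congr rfl fun k _ => ?_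
  rw [integral_finsetSum _ fun l _ => (hF' j k l).integral_prod_left]
  refine Finset.sum_congr rfl fun l _ => ?_
  rw [volume_restrict_prod_univ, integral_prod _ (hF' j k l)]

/-! ### Scale-invariant bounds, exponential weights and the heat flow -/

/-- The scale-invariant bound `|x|^a t^{(1-a)/2} |u(t,x)| ≤ M` for `t > 0`. -/
def CriticalBound (a M : ℝ) (u : ℝ → Space d → Space d) : Prop :=
  ∀ (t : ℝ) (x : Space d), 0 < t → ‖x‖ ^ a * t ^ ((1 - a) / 2) * ‖u t x‖ ≤ M

lemma CriticalBound.nonneg {a M : ℝ} {u : ℝ → Space d → Space d} (h : CriticalBound a M u) :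
    0 ≤ M := le_trans (by positivity) (h 1 0 one_pos)

lemma CriticalBound.norm_le {a M : ℝ} {u : ℝ → Space d → Space d} (h : CriticalBound a M u)
    {t : ℝ} (ht : 0 < t) {y : Space d} (hy : y ≠ 0) :
    ‖u t y‖ ≤ M * (‖y‖ ^ (-a) * t ^ (-((1 - a) / 2))) := by
  have hy' : 0 < ‖y‖ := norm_pos_iff.2 hy
  rw [Real.rpow_neg hy'.le, Real.rpow_neg ht.le, ← mul_inv, ← div_eq_mul_inv,
    le_div_iff₀ (by positivity), mul_comm]
  exact h t y ht

/-- The critical bounds interpolate. -/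
lemma CriticalBound.interpolate {M a : ℝ} {u : ℝ → Space d → Space d} (h0 : CriticalBound 0 M u)
    (h1 : CriticalBound 1 M u) (ha0 : 0 ≤ a) (ha1 : a ≤ 1) : CriticalBound a M u := by
  intro t x ht
  have e0 := h0 t x ht
  have e1 := h1 t x ht
  simp only [Real.rpow_zero, one_mul, sub_zero, Real.rpow_one, sub_self, zero_div, mul_one]
    at e0 e1
  have hM := h0.nonneg
  calc ‖x‖ ^ a * t ^ ((1 - a) / 2) * ‖u t x‖
      = (‖x‖ * ‖u t x‖) ^ a * (t ^ ((1 : ℝ) / 2) * ‖u t x‖) ^ (1 - a) := by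
        rw [Real.mul_rpow (norm_nonneg _) (norm_nonneg _),
          Real.mul_rpow (by positivity) (norm_nonneg _), ← Real.rpow_mul ht.le]
        have : ‖u t x‖ = ‖u t x‖ ^ a * ‖u t x‖ ^ (1 - a) := by
          rw [← Real.rpow_add_of_nonneg (norm_nonneg _) ha0 (by linarith), add_sub_cancel,
            Real.rpow_one]
        conv_lhs => rw [this]
        rw [show (1 : ℝ) / 2 * (1 - a) = (1 - a) / 2 by ring]
        ring
    _ ≤ M ^ a * M ^ (1 - a) := by
        gcongr
    _ = M := by
        rw [← Real.rpow_add_of_nonneg hM ha0 (by linarith), add_sub_cancel, Real.rpow_one]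

/-- The Duhamel operator maps tensor fields of size `|y|^{-(α+a)} τ^{-1+(α+a)/2}` to vector fields
with the critical bound of index `a`. Of the factor
`(|x| + √(t-τ))^{-(α+a)}` coming from the convolution in space, `(t-τ)^{-α/2}` goes into the time
integral and `|x|^{-a}` into the weight; for `x = 0` the latter is possible only if `a = 0`. -/
theorem exists_criticalBound_duhamel (hd : 2 ≤ d) {α a : ℝ} (hα0 : 0 < α) (hα1 : α < 1)
    (ha0 : 0 ≤ a) (ha1 : a ≤ 1) :
    ∃ C : ℝ, 0 < C ∧ ∀ (F : ℝ → Space d → Matrix (Fin d) (Fin d) ℝ) (M : ℝ),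
      (∀ k l, Measurable fun p : ℝ × Space d => F p.1 p.2 k l) → 0 ≤ M →
      (∀ τ : ℝ, 0 < τ → ∀ y : Space d, y ≠ 0 → ∀ k l,
        |F τ y k l| ≤ M * (‖y‖ ^ (-(α + a)) * τ ^ (-(1 - (α + a) / 2)))) →
      CriticalBound a (C * M) (duhamel F) ∧
      (a = 0 → ∀ (t : ℝ) (x : Space d), 0 < t → DuhamelIntegrable F t x) := by
  have hd' : (2 : ℝ) ≤ d := by exact_mod_cast hd
  obtain ⟨A, hA, hD⟩ := exists_integral_lerayHeatKernel_mul_le (d := d) (by omega)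
    (γ := α + a) (by linarith) (by linarith)
  obtain ⟨B, hB, hT⟩ := exists_integral_rpow_mul_rpow_le (p := (1 + α) / 2)
    (q := 1 - (α + a) / 2) (by linarith) (by linarith) (by linarith) (by linarith)
  refine ⟨(d : ℝ) ^ 3 * (A * B), by positivity, fun F M hF hM hFb => ?_⟩
  have main : ∀ (t : ℝ) (x : Space d), 0 < t → (x ≠ 0 ∨ a = 0) → ∀ j k l,
      IntegrableOn (fun p : ℝ × Space d =>
        lerayHeatKernel (t - p.1) j k l (x - p.2) * F p.1 p.2 k l) (Ioo 0 t ×ˢ univ) ∧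
      |∫ p in Ioo 0 t ×ˢ (univ : Set (Space d)),
        lerayHeatKernel (t - p.1) j k l (x - p.2) * F p.1 p.2 k l| ≤
        A * M * (‖x‖ ^ (-a) * (B * t ^ (-((1 - a) / 2)))) := by
    intro t x ht hx j k l
    obtain ⟨iT, vT⟩ := hT t ht
    obtain ⟨r1, r2⟩ := hD j k l (fun p => F p.1 p.2 k l) (fun τ => τ ^ (-(1 - (α + a) / 2)))
      (fun τ => ‖x‖ ^ (-a) * ((t - τ) ^ (-((1 + α) / 2)) * τ ^ (-(1 - (α + a) / 2)))) M t x (hF k l)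
      (by fun_prop) hM (fun τ hτ => Real.rpow_nonneg hτ.1.le _)
      (fun τ hτ y hy => hFb τ hτ.1 y hy k l) (iT.const_mul _) (fun τ hτ => by
        have hs : 0 < t - τ := by linarith [hτ.2]
        have hτ0 : 0 < τ := hτ.1
        have hσ := Real.sqrt_pos.2 hs
        rw [← mul_assoc]
        gcongr ?_ * _
        have e1 : (‖x‖ + Real.sqrt (t - τ)) ^ (-a) ≤ ‖x‖ ^ (-a) := by
          rcases hx with hx | rfl
          · exact Real.rpow_le_rpow_of_nonpos (norm_pos_iff.2 hx) (by linarith) (by linarith)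
          · simp
        have e2 : (‖x‖ + Real.sqrt (t - τ)) ^ (-α) ≤ Real.sqrt (t - τ) ^ (-α) :=
          Real.rpow_le_rpow_of_nonpos hσ (by linarith [norm_nonneg x]) (by linarith)
        calc (Real.sqrt (t - τ))⁻¹ * (‖x‖ + Real.sqrt (t - τ)) ^ (-(α + a))
            = (Real.sqrt (t - τ))⁻¹ * ((‖x‖ + Real.sqrt (t - τ)) ^ (-α) *
                (‖x‖ + Real.sqrt (t - τ)) ^ (-a)) := by
              rw [← Real.rpow_add (by positivity)]; ring_nf
          _ ≤ (Real.sqrt (t - τ))⁻¹ * (Real.sqrt (t - τ) ^ (-α) * ‖x‖ ^ (-a)) := by gcongr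
          _ = ‖x‖ ^ (-a) * (t - τ) ^ (-((1 + α) / 2)) := by
              rw [← mul_assoc, ← Real.rpow_neg_one, ← Real.rpow_add hσ, Real.sqrt_eq_rpow,
                ← Real.rpow_mul hs.le, mul_comm]
              ring_nf)
    refine ⟨r1, r2.trans ?_⟩
    rw [integral_const_mul]
    gcongr
    refine vT.trans_eq ?_
    ring_nf
  refine ⟨fun t x ht => ?_, fun ha t x ht j k l => (main t x ht (Or.inr ha) j k l).1⟩
  by_cases hx : x ≠ 0 ∨ a = 0
  · have h1 : ‖x‖ ^ a * ‖x‖ ^ (-a) = 1 := by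
      rcases hx with hx | rfl
      · rw [← Real.rpow_add (norm_pos_iff.2 hx), add_neg_cancel, Real.rpow_zero]
      · simp
    have h2 : t ^ ((1 - a) / 2) * t ^ (-((1 - a) / 2)) = 1 := by
      rw [← Real.rpow_add ht, add_neg_cancel, Real.rpow_zero]
    calc _ ≤ ‖x‖ ^ a * t ^ ((1 - a) / 2) *
          ((d : ℝ) ^ 3 * (A * M * (‖x‖ ^ (-a) * (B * t ^ (-((1 - a) / 2)))))) := by
          gcongr
          exact norm_duhamel_le fun j k l => (main t x ht hx j k l).2
      _ = (d : ℝ) ^ 3 * (A * B) * M * (‖x‖ ^ a * ‖x‖ ^ (-a)) *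
          (t ^ ((1 - a) / 2) * t ^ (-((1 - a) / 2))) := by ring
      _ = _ := by rw [h1, h2, mul_one, mul_one]
  · push Not at hx
    rw [hx.1, norm_zero, Real.zero_rpow hx.2, zero_mul, zero_mul]
    positivity

/-- With the exponential weight `e^{λτ}`, the Duhamel operator gains the small factor `λ^{-a/2}`
in the weight `|x|^β` away from the origin. -/
theorem exists_norm_duhamel_exp_le (hd : 1 ≤ d) {a β : ℝ} (ha0 : 0 < a) (ha1 : a < 1)
    (hβ0 : 0 ≤ β) (haβ : a + β < d) :
    ∃ C : ℝ, 0 < C ∧ ∀ (F : ℝ → Space d → Matrix (Fin d) (Fin d) ℝ) (M lam : ℝ),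
      (∀ k l, Measurable fun p : ℝ × Space d => F p.1 p.2 k l) → 0 ≤ M → 0 < lam →
      (∀ τ : ℝ, 0 < τ → ∀ y : Space d, y ≠ 0 → ∀ k l,
        |F τ y k l| ≤ M * (‖y‖ ^ (-(a + β)) * (τ ^ (-((1 - a) / 2)) * Real.exp (lam * τ)))) →
      ∀ (t : ℝ) (x : Space d), 0 < t → 1 ≤ ‖x‖ →
        ‖x‖ ^ β * ‖duhamel F t x‖ ≤ C * (lam ^ (-(a / 2)) * Real.exp (lam * t)) * M := by
  obtain ⟨A, hA, hD⟩ := exists_integral_lerayHeatKernel_mul_le (d := d) hd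
    (γ := a + β) (by linarith) haβ
  obtain ⟨B, hB, hT⟩ := exists_integral_rpow_mul_rpow_le (p := (1 + a) / 2)
    (q := (1 - a) / 2) (by linarith) (by linarith) (by linarith) (by linarith)
  refine ⟨(d : ℝ) ^ 3 * (A * B), by positivity, fun F M lam hF hM hlam hFb t x ht hx => ?_⟩
  obtain ⟨iT, vT⟩ := hT t ht
  have hx0 : 0 < ‖x‖ := by linarith
  set E := lam ^ (-(a / 2)) * Real.exp (lam * t)
  have main : ∀ j k l, |∫ p in Ioo 0 t ×ˢ (univ : Set (Space d)),
        lerayHeatKernel (t - p.1) j k l (x - p.2) * F p.1 p.2 k l| ≤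
        A * M * (‖x‖ ^ (-β) * E * B) := by
    intro j k l
    obtain ⟨-, r2⟩ := hD j k l (fun p => F p.1 p.2 k l)
      (fun τ => τ ^ (-((1 - a) / 2)) * Real.exp (lam * τ))
      (fun τ => ‖x‖ ^ (-β) * E * ((t - τ) ^ (-((1 + a) / 2)) * τ ^ (-((1 - a) / 2)))) M t x (hF k l)
      (by fun_prop) hM (fun τ hτ => mul_nonneg (Real.rpow_nonneg hτ.1.le _) (Real.exp_nonneg _))
      (fun τ hτ y hy => hFb τ hτ.1 y hy k l) (iT.const_mul _) (fun τ hτ => by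
        have hs : 0 < t - τ := by linarith [hτ.2]
        have hτ0 : 0 < τ := hτ.1
        have hσ := Real.sqrt_pos.2 hs
        have e1 : (‖x‖ + Real.sqrt (t - τ)) ^ (-(a + β)) ≤ ‖x‖ ^ (-β) :=
          (Real.rpow_le_rpow_of_nonpos hx0 (by linarith) (by linarith)).trans
            (Real.rpow_le_rpow_of_exponent_le hx (by linarith))
        -- the factor `λ^{-a/2}` comes from `z^{a/2} ≤ e^z` at `z = λ(t-τ)`
        have e2 : Real.exp (lam * τ) ≤ E * (t - τ) ^ (-(a / 2)) := by
          set z := lam * (t - τ) with hz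
          have hz0 : 0 < z := by positivity
          have e3 : z ^ (a / 2) ≤ Real.exp z := by
            calc z ^ (a / 2) ≤ (z + 1) ^ (a / 2) := by gcongr; linarith
              _ ≤ (z + 1) ^ (1 : ℝ) :=
                Real.rpow_le_rpow_of_exponent_le (by linarith) (by linarith)
              _ ≤ _ := by rw [Real.rpow_one]; exact Real.add_one_le_exp z
          have e4 : E * (t - τ) ^ (-(a / 2)) = z ^ (-(a / 2)) * Real.exp z * Real.exp (lam * τ) := by
            have : Real.exp (lam * t) = Real.exp z * Real.exp (lam * τ) := by
              rw [← Real.exp_add, hz]; ring_nf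
            simp only [E]
            rw [this, hz, Real.mul_rpow hlam.le hs.le]
            ring
          rw [e4]
          refine le_mul_of_one_le_left (Real.exp_nonneg _) ?_
          rw [Real.rpow_neg hz0.le, ← div_eq_inv_mul, one_le_div (by positivity)]
          exact e3
        calc (Real.sqrt (t - τ))⁻¹ * (‖x‖ + Real.sqrt (t - τ)) ^ (-(a + β)) *
              (τ ^ (-((1 - a) / 2)) * Real.exp (lam * τ))
            ≤ (Real.sqrt (t - τ))⁻¹ * ‖x‖ ^ (-β) *
              (τ ^ (-((1 - a) / 2)) * (E * (t - τ) ^ (-(a / 2)))) := by gcongr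
          _ = ‖x‖ ^ (-β) * E * (((Real.sqrt (t - τ))⁻¹ * (t - τ) ^ (-(a / 2))) *
                τ ^ (-((1 - a) / 2))) := by ring
          _ = _ := by
              rw [Real.sqrt_eq_rpow, ← Real.rpow_neg hs.le, ← Real.rpow_add hs]
              ring_nf)
    refine r2.trans ?_
    rw [integral_const_mul]
    gcongr
    refine vT.trans_eq ?_
    rw [show 1 - (1 + a) / 2 - (1 - a) / 2 = 0 by ring, Real.rpow_zero, mul_one]
  have h1 : ‖x‖ ^ β * ‖x‖ ^ (-β) = 1 := by
    rw [← Real.rpow_add hx0, add_neg_cancel, Real.rpow_zero]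
  calc _ ≤ ‖x‖ ^ β * ((d : ℝ) ^ 3 * (A * M * (‖x‖ ^ (-β) * E * B))) := by
        gcongr
        exact norm_duhamel_le main
    _ = (d : ℝ) ^ 3 * (A * B) * E * M * (‖x‖ ^ β * ‖x‖ ^ (-β)) := by ring
    _ = _ := by rw [h1, mul_one]

/-- The heat kernel is dominated by `√t (|x| + √t)^{-(d+1)}`. -/
lemma exists_heatKernel_le (d : ℕ) : ∃ C : ℝ, 0 < C ∧ ∀ (t : ℝ), 0 < t → ∀ x : Space d,
    0 ≤ heatKernel t x ∧
      heatKernel t x ≤ C * (Real.sqrt t * ((‖x‖ + Real.sqrt t) ^ (d + 1))⁻¹) := by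
  obtain ⟨B, hB, hBr⟩ := exists_one_add_pow_mul_exp_neg_le (d + 1) (c := 1 / 4) (by norm_num)
  refine ⟨(4 * Real.pi) ^ (-(d : ℝ) / 2) * B, by positivity, fun t ht x =>
    ⟨by unfold heatKernel; positivity, ?_⟩⟩
  have hr : 0 < Real.sqrt t := Real.sqrt_pos.2 ht
  have h1 := hBr (‖x‖ / Real.sqrt t) (by positivity)
  have h2 : (‖x‖ + Real.sqrt t) ^ (d + 1) =
      (1 + ‖x‖ / Real.sqrt t) ^ (d + 1) * Real.sqrt t ^ (d + 1) := by
    rw [← mul_pow, add_mul, div_mul_cancel₀ _ hr.ne', one_mul, add_comm]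
  have h3 : -(1 / 4 * (‖x‖ / Real.sqrt t) ^ 2) = -‖x‖ ^ 2 / (4 * t) := by
    rw [div_pow, Real.sq_sqrt ht.le]; field_simp
  rw [h3] at h1
  have h4 : t ^ (-(d : ℝ) / 2) = (Real.sqrt t ^ d)⁻¹ := (sqrt_pow_inv_eq_rpow ht d).symm
  rw [heatKernel, Real.mul_rpow (by positivity) ht.le, h4, h2, pow_succ (Real.sqrt t)]
  calc _ = (4 * Real.pi) ^ (-(d : ℝ) / 2) * (Real.sqrt t ^ d)⁻¹ *
        Real.exp (-‖x‖ ^ 2 / (4 * t)) := by ring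
    _ ≤ (4 * Real.pi) ^ (-(d : ℝ) / 2) * (Real.sqrt t ^ d)⁻¹ *
        (B * ((1 + ‖x‖ / Real.sqrt t) ^ (d + 1))⁻¹) := by
        gcongr
        rw [← div_eq_mul_inv, le_div_iff₀ (by positivity), mul_comm]
        exact h1
    _ = _ := by field_simp

/-- The heat semigroup on data dominated by `|y|^{-γ}`. -/
theorem exists_norm_heat_le (hd : 1 ≤ d) {γ : ℝ} (hγ0 : 0 ≤ γ) (hγ : γ < d) :
    ∃ C : ℝ, 0 < C ∧ ∀ (f : Space d → Space d) (A : ℝ), AEStronglyMeasurable f volume →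
      0 ≤ A → (∀ᵐ y, ‖f y‖ ≤ A * ‖y‖ ^ (-γ)) → ∀ (t : ℝ) (x : Space d), 0 < t →
      Integrable (fun y => heatKernel t (x - y) • f y) ∧
      ‖heat t f x‖ ≤ C * A * (‖x‖ + Real.sqrt t) ^ (-γ) := by
  obtain ⟨B, hB, hS⟩ := exists_integral_convolution_rpow_le hd hγ0 hγ
  obtain ⟨K, hK, hH⟩ := exists_heatKernel_le d
  refine ⟨K * B, by positivity, fun f A hf hA hfb t x ht => ?_⟩
  have hr : 0 < Real.sqrt t := Real.sqrt_pos.2 ht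
  obtain ⟨i, v⟩ := hS x _ hr
  have hbd : ∀ᵐ y, ‖heatKernel t (x - y) • f y‖ ≤ K * A * Real.sqrt t *
      (((‖x - y‖ + Real.sqrt t) ^ (d + 1))⁻¹ * ‖y‖ ^ (-γ)) := by
    filter_upwards [hfb] with y hy
    obtain ⟨h0, h1⟩ := hH t ht (x - y)
    rw [norm_smul, Real.norm_of_nonneg h0]
    calc _ ≤ K * (Real.sqrt t * ((‖x - y‖ + Real.sqrt t) ^ (d + 1))⁻¹) * (A * ‖y‖ ^ (-γ)) := by
          gcongr
      _ = _ := by ring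
  have hm : Measurable fun y : Space d => heatKernel t (x - y) := by
    unfold heatKernel; fun_prop
  refine ⟨(i.const_mul _).mono' (hm.aestronglyMeasurable.smul hf) hbd, ?_⟩
  refine (norm_integral_le_of_norm_le (i.const_mul _) hbd).trans ?_
  rw [integral_const_mul]
  calc _ ≤ K * A * Real.sqrt t * (B * ((Real.sqrt t)⁻¹ * (‖x‖ + Real.sqrt t) ^ (-γ))) := by
        gcongr
    _ = _ := by field_simp

lemma measurable_heat {f : Space d → Space d} (hf : StronglyMeasurable f) :
    Measurable fun p : ℝ × Space d => heat p.1 f p.2 := by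
  have hm : Measurable fun q : (ℝ × Space d) × Space d => heatKernel q.1.1 (q.1.2 - q.2) := by
    unfold heatKernel; fun_prop
  have := (hm.stronglyMeasurable.smul (hf.comp_measurable measurable_snd)).integral_prod_right'
    (ν := (volume : Measure (Space d)))
  exact this.measurable

/-! ### Picard iteration -/

lemma CriticalBound.mono {a M M' : ℝ} {u : ℝ → Space d → Space d} (h : CriticalBound a M u)
    (hM : M ≤ M') : CriticalBound a M' u := fun t x ht => (h t x ht).trans hM

lemma CriticalBound.sub {a M M' : ℝ} {u v : ℝ → Space d → Space d} (hu : CriticalBound a M u)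
    (hv : CriticalBound a M' v) : CriticalBound a (M + M') (fun t x => u t x - v t x) := by
  intro t x ht
  calc _ ≤ ‖x‖ ^ a * t ^ ((1 - a) / 2) * (‖u t x‖ + ‖v t x‖) := by
        gcongr; exact norm_sub_le _ _
    _ ≤ _ := by rw [mul_add]; exact add_le_add (hu t x ht) (hv t x ht)

lemma CriticalBound.of_tendsto {a M : ℝ} {u : ℕ → ℝ → Space d → Space d} {v : ℝ → Space d → Space d}
    (hu : ∀ n, CriticalBound a M (u n))
    (h : ∀ t x, Filter.Tendsto (fun n => u n t x) Filter.atTop (nhds (v t x))) :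
    CriticalBound a M v := fun t x ht =>
  le_of_tendsto ((h t x).norm.const_mul _) (.of_forall fun n => hu n t x ht)

lemma measurable_tensor {u v : ℝ → Space d → Space d}
    (hu : Measurable fun p : ℝ × Space d => u p.1 p.2)
    (hv : Measurable fun p : ℝ × Space d => v p.1 p.2) (k l : Fin d) :
    Measurable fun p : ℝ × Space d => tensor (u p.1) (v p.1) p.2 k l := by
  simp only [tensor, Matrix.of_apply]
  exact ((EuclideanSpace.proj (𝕜 := ℝ) k).continuous.measurable.comp hu).mul
    ((EuclideanSpace.proj (𝕜 := ℝ) l).continuous.measurable.comp hv)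

lemma abs_tensor_le (u v : Space d → Space d) (y : Space d) (k l : Fin d) :
    |tensor u v y k l| ≤ ‖u y‖ * ‖v y‖ := by
  simp only [tensor, Matrix.of_apply, abs_mul]
  gcongr <;> exact abs_apply_le_norm _ _

/-- The product of two fields with critical bounds of indices `α` and `a`. -/
lemma CriticalBound.norm_mul_norm_le {α a M N : ℝ} {u v : ℝ → Space d → Space d}
    (hu : CriticalBound α M u) (hv : CriticalBound a N v) {τ : ℝ} (hτ : 0 < τ) {y : Space d}
    (hy : y ≠ 0) :
    ‖u τ y‖ * ‖v τ y‖ ≤ M * N * (‖y‖ ^ (-(α + a)) * τ ^ (-(1 - (α + a) / 2))) := by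
  have hy' : 0 < ‖y‖ := norm_pos_iff.2 hy
  calc _ ≤ (M * (‖y‖ ^ (-α) * τ ^ (-((1 - α) / 2)))) * (N * (‖y‖ ^ (-a) * τ ^ (-((1 - a) / 2)))) :=
        mul_le_mul (hu.norm_le hτ hy) (hv.norm_le hτ hy) (norm_nonneg _)
          ((norm_nonneg _).trans (hu.norm_le hτ hy))
    _ = M * N * ((‖y‖ ^ (-α) * ‖y‖ ^ (-a)) * (τ ^ (-((1 - α) / 2)) * τ ^ (-((1 - a) / 2)))) := by
        ring
    _ = _ := by
        rw [← Real.rpow_add hy', ← Real.rpow_add hτ]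
        ring_nf

/-- `C` is admissible in the estimate of the Duhamel operator for the indices `0`, `α` and `1`
simultaneously. -/
def IsDuhamelConstant (d : ℕ) (α C : ℝ) : Prop :=
  ∀ a : ℝ, (a = 0 ∨ a = α ∨ a = 1) →
    ∀ (F : ℝ → Space d → Matrix (Fin d) (Fin d) ℝ) (M : ℝ),
      (∀ k l, Measurable fun p : ℝ × Space d => F p.1 p.2 k l) → 0 ≤ M →
      (∀ τ : ℝ, 0 < τ → ∀ y : Space d, y ≠ 0 → ∀ k l,
        |F τ y k l| ≤ M * (‖y‖ ^ (-(α + a)) * τ ^ (-(1 - (α + a) / 2)))) →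
      CriticalBound a (C * M) (duhamel F) ∧
      (a = 0 → ∀ (t : ℝ) (x : Space d), 0 < t → DuhamelIntegrable F t x)

lemma exists_isDuhamelConstant (hd : 2 ≤ d) {α : ℝ} (hα0 : 0 < α) (hα1 : α < 1) :
    ∃ C : ℝ, 0 < C ∧ IsDuhamelConstant d α C := by
  obtain ⟨A, hA, h0⟩ := exists_criticalBound_duhamel hd hα0 hα1 le_rfl zero_le_one
  obtain ⟨B, hB, h1⟩ := exists_criticalBound_duhamel hd hα0 hα1 hα0.le hα1.le
  obtain ⟨D, hD, h2⟩ := exists_criticalBound_duhamel hd hα0 hα1 zero_le_one le_rfl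
  refine ⟨A + B + D, by positivity, fun a ha F M hF hM hFb => ?_⟩
  rcases ha with rfl | rfl | rfl
  · obtain ⟨r1, r2⟩ := h0 F M hF hM hFb
    exact ⟨r1.mono (by gcongr; linarith), r2⟩
  · obtain ⟨r1, r2⟩ := h1 F M hF hM hFb
    exact ⟨r1.mono (by gcongr; linarith), r2⟩
  · obtain ⟨r1, r2⟩ := h2 F M hF hM hFb
    exact ⟨r1.mono (by gcongr; linarith), r2⟩

section FixedPoint

variable {α C : ℝ}

lemma IsDuhamelConstant.criticalBound_tensor (hC : IsDuhamelConstant d α C) {a : ℝ}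
    (ha : a = 0 ∨ a = α ∨ a = 1) {u v : ℝ → Space d → Space d}
    (hu : Measurable fun p : ℝ × Space d => u p.1 p.2)
    (hv : Measurable fun p : ℝ × Space d => v p.1 p.2) {M N : ℝ}
    (hub : CriticalBound α M u) (hvb : CriticalBound a N v) :
    CriticalBound a (C * (M * N)) (duhamel fun τ => tensor (u τ) (v τ)) :=
  (hC a ha _ _ (measurable_tensor hu hv) (mul_nonneg hub.nonneg hvb.nonneg)
    fun _ hτ _ hy _ _ => (abs_tensor_le _ _ _ _ _).trans (hub.norm_mul_norm_le hvb hτ hy)).1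

lemma IsDuhamelConstant.duhamelIntegrable_tensor (hC : IsDuhamelConstant d α C)
    {u v : ℝ → Space d → Space d}
    (hu : Measurable fun p : ℝ × Space d => u p.1 p.2)
    (hv : Measurable fun p : ℝ × Space d => v p.1 p.2) {M N : ℝ}
    (hub : CriticalBound α M u) (hvb : CriticalBound 0 N v) {t : ℝ} (ht : 0 < t) (x : Space d) :
    DuhamelIntegrable (fun τ => tensor (u τ) (v τ)) t x :=
  (hC 0 (Or.inl rfl) _ _ (measurable_tensor hu hv) (mul_nonneg hub.nonneg hvb.nonneg)
    fun _ hτ _ hy _ _ => (abs_tensor_le _ _ _ _ _).trans (hub.norm_mul_norm_le hvb hτ hy)).2 rfl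
    t x ht

/-- Lipschitz estimate for `u ↦ ∫_0^t e^{(t-τ)Δ} ℙ ∇·(u ⊗ u) dτ` in the norm
`sup t^{1/2} |u|`. -/
lemma IsDuhamelConstant.criticalBound_duhamel_sub (hC : IsDuhamelConstant d α C)
    {u v : ℝ → Space d → Space d}
    (hu : Measurable fun p : ℝ × Space d => u p.1 p.2)
    (hv : Measurable fun p : ℝ × Space d => v p.1 p.2) {M N N' e : ℝ}
    (hub : CriticalBound α M u) (hvb : CriticalBound α M v)
    (hub0 : CriticalBound 0 N u) (hvb0 : CriticalBound 0 N' v)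
    (he : CriticalBound 0 e fun t x => u t x - v t x) :
    CriticalBound 0 (C * (2 * M * e)) (fun t x =>
      duhamel (fun τ => tensor (u τ) (u τ)) t x - duhamel (fun τ => tensor (v τ) (v τ)) t x) := by
  have key := (hC 0 (Or.inl rfl) (fun τ y => tensor (u τ) (u τ) y - tensor (v τ) (v τ) y)
    (2 * M * e) (fun k l => by
      simp only [Matrix.sub_apply]
      exact (measurable_tensor hu hu k l).sub (measurable_tensor hv hv k l))
    (mul_nonneg (mul_nonneg zero_le_two hub.nonneg) he.nonneg) (fun τ hτ y hy k l => by
      have e1 := hub.norm_mul_norm_le he hτ hy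
      have e2 := hvb.norm_mul_norm_le he hτ hy
      have e3 : (tensor (u τ) (u τ) y - tensor (v τ) (v τ) y) k l =
          u τ y k * (u τ y - v τ y) l + v τ y l * (u τ y - v τ y) k := by
        simp only [tensor, Matrix.sub_apply, Matrix.of_apply, PiLp.sub_apply]; ring
      rw [e3]
      calc _ ≤ |u τ y k| * |(u τ y - v τ y) l| + |v τ y l| * |(u τ y - v τ y) k| := by
            rw [← abs_mul, ← abs_mul]; exact abs_add_le _ _
        _ ≤ ‖u τ y‖ * ‖u τ y - v τ y‖ + ‖v τ y‖ * ‖u τ y - v τ y‖ := by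
            gcongr <;> exact abs_apply_le_norm _ _
        _ ≤ _ := by linarith)).1
  intro t x ht
  have := key t x ht
  rwa [duhamel_sub (hC.duhamelIntegrable_tensor hu hu hub hub0 ht x)
    (hC.duhamelIntegrable_tensor hv hv hvb hvb0 ht x)] at this

/-- Picard iterates of `u = w - ∫_0^t e^{(t-τ)Δ} ℙ ∇·(u ⊗ u) dτ`, starting from `w`. -/
def picard (w : ℝ → Space d → Space d) : ℕ → ℝ → Space d → Space d
  | 0 => w
  | n + 1 => fun t x => w t x - duhamel (fun τ => tensor (picard w n τ) (picard w n τ)) t x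

lemma picard_succ (w : ℝ → Space d → Space d) (n : ℕ) (t : ℝ) (x : Space d) :
    picard w (n + 1) t x =
      w t x - duhamel (fun τ => tensor (picard w n τ) (picard w n τ)) t x := rfl

variable {w : ℝ → Space d → Space d}

lemma measurable_picard (hw : Measurable fun p : ℝ × Space d => w p.1 p.2) (n : ℕ) :
    Measurable fun p : ℝ × Space d => picard w n p.1 p.2 := by
  induction n with
  | zero => exact hw
  | succ n ih => exact hw.sub (measurable_duhamel (measurable_tensor ih ih))

variable {δ N : ℝ}

lemma criticalBound_picard (hC : IsDuhamelConstant d α C)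
    (hw : Measurable fun p : ℝ × Space d => w p.1 p.2) (hδ : 8 * C * δ ≤ 1)
    (hwα : CriticalBound α δ w) (n : ℕ) : CriticalBound α (2 * δ) (picard w n) := by
  have hδ0 := hwα.nonneg
  induction n with
  | zero => exact hwα.mono (by linarith)
  | succ n ih =>
    have hm := measurable_picard hw n
    refine (hwα.sub (hC.criticalBound_tensor (Or.inr (Or.inl rfl)) hm hm ih ih)).mono ?_
    nlinarith

/-- Smallness in the index `α` alone propagates any critical bound of index `0` or `1`. -/
lemma criticalBound_picard_of_small (hC : IsDuhamelConstant d α C)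
    (hw : Measurable fun p : ℝ × Space d => w p.1 p.2) (hδ : 8 * C * δ ≤ 1)
    (hwα : CriticalBound α δ w) {a : ℝ} (ha : a = 0 ∨ a = α ∨ a = 1)
    (hwa : CriticalBound a N w) (n : ℕ) : CriticalBound a (2 * N) (picard w n) := by
  have hN0 := hwa.nonneg
  induction n with
  | zero => exact hwa.mono (by linarith)
  | succ n ih =>
    have hm := measurable_picard hw n
    refine (hwa.sub (hC.criticalBound_tensor ha hm hm
      (criticalBound_picard hC hw hδ hwα n) ih)).mono ?_
    nlinarith

lemma criticalBound_picard_succ_sub (hC : IsDuhamelConstant d α C)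
    (hw : Measurable fun p : ℝ × Space d => w p.1 p.2) (hδ : 8 * C * δ ≤ 1)
    (hwα : CriticalBound α δ w) (hw0 : CriticalBound 0 N w) (n : ℕ) :
    CriticalBound 0 (4 * N * (1 / 2) ^ n) (fun t x => picard w n t x - picard w (n + 1) t x) := by
  have hb := criticalBound_picard hC hw hδ hwα
  have hb0 := criticalBound_picard_of_small hC hw hδ hwα (Or.inl rfl) hw0
  have hm := measurable_picard hw
  induction n with
  | zero => exact ((hb0 0).sub (hb0 1)).mono (by rw [pow_zero]; linarith)
  | succ n ih =>
    have hs := hC.criticalBound_duhamel_sub (hm n) (hm (n + 1)) (hb n) (hb (n + 1)) (hb0 n)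
      (hb0 (n + 1)) ih
    intro t x ht
    have := hs t x ht
    rw [norm_sub_rev] at this
    have e : picard w (n + 1) t x - picard w (n + 1 + 1) t x =
        duhamel (fun τ => tensor (picard w (n + 1) τ) (picard w (n + 1) τ)) t x -
          duhamel (fun τ => tensor (picard w n τ) (picard w n τ)) t x := by
      rw [picard_succ w (n + 1), picard_succ w n]; abel
    beta_reduce
    rw [e]
    refine this.trans ?_
    have hN : 0 ≤ N * (1 / 2) ^ n := mul_nonneg hw0.nonneg (by positivity)
    rw [pow_succ]
    nlinarith

/-- The Picard iterates converge pointwise to a solution of the integral equation. -/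
theorem exists_tendsto_picard (hC : IsDuhamelConstant d α C)
    (hw : Measurable fun p : ℝ × Space d => w p.1 p.2) (hδ : 8 * C * δ ≤ 1)
    (hwα : CriticalBound α δ w) (hw0 : CriticalBound 0 N w) :
    ∃ u : ℝ → Space d → Space d, (Measurable fun p : ℝ × Space d => u p.1 p.2) ∧
      (∀ t x, Filter.Tendsto (fun n => picard w n t x) Filter.atTop (nhds (u t x))) ∧
      ∀ t x, 0 < t → DuhamelIntegrable (fun τ => tensor (u τ) (u τ)) t x ∧
        u t x = w t x - duhamel (fun τ => tensor (u τ) (u τ)) t x := by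
  have hb := criticalBound_picard hC hw hδ hwα
  have hb0 := criticalBound_picard_of_small hC hw hδ hwα (Or.inl rfl) hw0
  have hm := measurable_picard hw
  have hdist : ∀ t x, 0 < t → ∀ n, dist (picard w n t x) (picard w (n + 1) t x) ≤
      4 * N / t ^ ((1 : ℝ) / 2) * (1 / 2) ^ n := fun t x ht n => by
    have := criticalBound_picard_succ_sub hC hw hδ hwα hw0 n t x ht
    rw [Real.rpow_zero, one_mul, sub_zero] at this
    rw [dist_eq_norm, div_mul_eq_mul_div, le_div_iff₀ (by positivity), mul_comm]
    exact this
  have hlim : ∀ t x, ∃ v, Filter.Tendsto (fun n => picard w n t x) Filter.atTop (nhds v) := by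
    intro t x
    rcases lt_or_ge 0 t with ht | ht
    · exact cauchySeq_tendsto_of_complete
        (cauchySeq_of_le_geometric (1 / 2) _ (by norm_num) (hdist t x ht))
    -- for `t ≤ 0` the Duhamel term vanishes, so that the iterates are constant
    · refine ⟨w t x, ?_⟩
      have : ∀ n, picard w n t x = w t x := fun n => by
        cases n with
        | zero => rfl
        | succ n =>
          rw [picard_succ, sub_eq_self]
          ext j
          simp [duhamel, Ioo_eq_empty (not_lt.2 ht)]
      simp [this]
  choose u hu using hlim
  have hum : Measurable fun p : ℝ × Space d => u p.1 p.2 :=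
    measurable_of_tendsto_metrizable hm (tendsto_pi_nhds.2 fun p => hu p.1 p.2)
  have hub : CriticalBound α (2 * δ) u := .of_tendsto hb hu
  have hub0 : CriticalBound 0 (2 * N) u := .of_tendsto hb0 hu
  refine ⟨u, hum, hu, fun t x ht => ⟨hC.duhamelIntegrable_tensor hum hum hub hub0 ht x, ?_⟩⟩
  have hsub : ∀ n, CriticalBound 0 (8 * N * (1 / 2) ^ n) (fun t x => picard w n t x - u t x) := by
    intro n t x ht
    have := dist_le_of_le_geometric_of_tendsto (1 / 2) _ (by norm_num) (hdist t x ht) (hu t x) n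
    rw [dist_eq_norm, show 4 * N / t ^ ((1 : ℝ) / 2) * (1 / 2) ^ n / (1 - 1 / 2) =
      8 * N * (1 / 2) ^ n / t ^ ((1 : ℝ) / 2) by ring, le_div_iff₀ (by positivity)] at this
    rw [Real.rpow_zero, one_mul, sub_zero, mul_comm]
    exact this
  have hD : Filter.Tendsto (fun n => duhamel (fun τ => tensor (picard w n τ) (picard w n τ)) t x)
      Filter.atTop (nhds (duhamel (fun τ => tensor (u τ) (u τ)) t x)) := by
    rw [tendsto_iff_norm_sub_tendsto_zero]
    have h0 : Filter.Tendsto (fun n : ℕ =>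
        C * (2 * (2 * δ) * (8 * N * (1 / 2) ^ n)) / t ^ ((1 : ℝ) / 2)) Filter.atTop (nhds 0) := by
      have := (tendsto_pow_atTop_nhds_zero_of_lt_one (r := (1 / 2 : ℝ)) (by norm_num)
        (by norm_num)).const_mul (C * (2 * (2 * δ) * (8 * N)) / t ^ ((1 : ℝ) / 2))
      rw [mul_zero] at this
      refine this.congr fun n => ?_
      ring
    refine squeeze_zero (fun n => norm_nonneg _) (fun n => ?_) h0
    have := hC.criticalBound_duhamel_sub (hm n) hum (hb n) hub (hb0 n) hub0 (hsub n) t x ht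
    rw [Real.rpow_zero, one_mul, sub_zero] at this
    rw [le_div_iff₀ (by positivity), mul_comm]
    exact this
  exact tendsto_nhds_unique ((Filter.tendsto_add_atTop_iff_nat 1).2 (hu t x)) (hD.const_sub (w t x))

/-- Propagation of the weight `|x|^β`, `β < d`. The iterates are measured in
`sup e^{-λt} |x|^β |u(t,x)|`; for `λ` large the Duhamel term is contracting for `|x| ≥ 1`, while
for `|x| ≤ 1` the weight is dominated by `|x|`. -/
theorem exists_pow_mul_norm_picard_le (hd : 1 ≤ d) {β N₀ : ℝ} (hβ1 : 1 ≤ β) (hβd : β < d)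
    (hw : Measurable fun p : ℝ × Space d => w p.1 p.2) (hN : 0 ≤ N)
    (h0 : ∀ n, CriticalBound 0 N (picard w n)) (h1 : ∀ n, CriticalBound 1 N (picard w n))
    (hwβ : ∀ t x, 0 < t → ‖x‖ ^ β * ‖w t x‖ ≤ N₀) :
    ∃ L lam : ℝ, 0 ≤ L ∧ 0 < lam ∧ ∀ n t x, 0 < t →
      ‖x‖ ^ β * ‖picard w n t x‖ ≤ L * Real.exp (lam * t) := by
  set a : ℝ := min (1 / 2) ((d - β) / 2)
  have ha0 : 0 < a := lt_min (by norm_num) (by linarith)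
  have ha1 : a < 1 := (min_le_left _ _).trans_lt (by norm_num)
  have haβ : a + β < d := by linarith [min_le_right (1 / 2 : ℝ) ((d - β) / 2)]
  obtain ⟨K, hK, hD⟩ := exists_norm_duhamel_exp_le hd ha0 ha1 (by linarith : 0 ≤ β) haβ
  have hN₀ : 0 ≤ N₀ := le_trans (by positivity) (hwβ 1 0 one_pos)
  set L : ℝ := N₀ + N
  have hL : 0 ≤ L := add_nonneg hN₀ hN
  -- `lam` is chosen so that `2 * K * N * lam ^ (-(a / 2)) ≤ 1`
  set Q : ℝ := 2 * K * N + 1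
  have hQ : 0 < Q := by positivity
  set lam : ℝ := Q ^ (2 / a)
  have hlam : 0 < lam := by positivity
  have hlamQ : lam ^ (-(a / 2)) = Q⁻¹ := by
    rw [← Real.rpow_mul hQ.le, show 2 / a * -(a / 2) = -1 by field_simp, Real.rpow_neg_one]
  have hm := measurable_picard hw
  refine ⟨2 * L, lam, by positivity, hlam, fun n => ?_⟩
  have hexp : ∀ t : ℝ, 0 < t → 1 ≤ Real.exp (lam * t) := fun t ht =>
    Real.one_le_exp (by positivity)
  induction n with
  | zero =>
    intro t x ht
    have e1 := hwβ t x ht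
    have := hexp t ht
    show ‖x‖ ^ β * ‖w t x‖ ≤ _
    nlinarith
  | succ n ih =>
    intro t x ht
    have hE := hexp t ht
    rcases le_total ‖x‖ 1 with hx | hx
    · have e1 := h1 (n + 1) t x ht
      rw [sub_self, zero_div, Real.rpow_zero, mul_one] at e1
      calc _ ≤ ‖x‖ ^ (1 : ℝ) * ‖picard w (n + 1) t x‖ := by
            gcongr ?_ * _
            rcases eq_or_lt_of_le (norm_nonneg x) with h | h
            · rw [← h, Real.zero_rpow (by linarith), Real.zero_rpow (by norm_num)]
            · exact Real.rpow_le_rpow_of_exponent_ge h hx hβ1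
        _ ≤ N := e1
        _ ≤ _ := by nlinarith
    · have hF := hD (fun τ => tensor (picard w n τ) (picard w n τ)) (N * (2 * L)) lam
        (measurable_tensor (hm n) (hm n)) (by positivity) hlam (fun τ hτ y hy k l => by
          have hy' : 0 < ‖y‖ := norm_pos_iff.2 hy
          have f1 := ((h0 n).interpolate (h1 n) ha0.le ha1.le).norm_le hτ hy
          have f2 : ‖picard w n τ y‖ ≤ 2 * L * Real.exp (lam * τ) * ‖y‖ ^ (-β) := by
            rw [Real.rpow_neg hy'.le, ← div_eq_mul_inv, le_div_iff₀ (by positivity), mul_comm]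
            exact ih τ y hτ
          calc _ ≤ _ := abs_tensor_le _ _ _ _ _
            _ ≤ (N * (‖y‖ ^ (-a) * τ ^ (-((1 - a) / 2)))) *
                  (2 * L * Real.exp (lam * τ) * ‖y‖ ^ (-β)) := by gcongr
            _ = N * (2 * L) * ((‖y‖ ^ (-a) * ‖y‖ ^ (-β)) *
                  (τ ^ (-((1 - a) / 2)) * Real.exp (lam * τ))) := by ring
            _ = _ := by rw [← Real.rpow_add hy', neg_add]) t x ht hx
      have hQ1 : 2 * K * N * Q⁻¹ ≤ 1 := by
        rw [← div_eq_mul_inv, div_le_one hQ]; simp only [Q]; linarith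
      calc _ ≤ ‖x‖ ^ β * (‖w t x‖ +
            ‖duhamel (fun τ => tensor (picard w n τ) (picard w n τ)) t x‖) := by
            gcongr; exact norm_sub_le _ _
        _ ≤ N₀ + K * (lam ^ (-(a / 2)) * Real.exp (lam * t)) * (N * (2 * L)) := by
            rw [mul_add]; exact add_le_add (hwβ t x ht) hF
        _ = N₀ + (2 * K * N * Q⁻¹) * (L * Real.exp (lam * t)) := by rw [hlamQ]; ring
        _ ≤ L * Real.exp (lam * t) + 1 * (L * Real.exp (lam * t)) := by
            gcongr
            nlinarith
        _ = _ := by ring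

end FixedPoint

lemma MemWeightedLinfty.exists_norm_le (hd : 1 ≤ d) {β : ℝ} {f : Space d → Space d}
    (hf : MemWeightedLinfty β f) :
    ∃ A : ℝ, 0 ≤ A ∧ ∀ᵐ y, ‖f y‖ ≤ A * ‖y‖ ^ (-β) := by
  obtain ⟨C, hC⟩ := hf.2
  have : Nonempty (Fin d) := ⟨⟨0, hd⟩⟩
  refine ⟨|C|, abs_nonneg C, ?_⟩
  filter_upwards [hC, (Measure.ae_ne volume (0 : Space d))] with y hy hy0
  have hy' : 0 < ‖y‖ := norm_pos_iff.2 hy0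
  rw [Real.rpow_neg hy'.le, ← div_eq_mul_inv, le_div_iff₀ (by positivity), mul_comm]
  exact hy.trans (le_abs_self C)

/-- The heat flow of `|x|^{-1}`-bounded data satisfies the critical bounds of indices `0`
and `1`. -/
lemma exists_criticalBound_heat (hd : 2 ≤ d) {f : Space d → Space d} (hf : MemWeightedLinfty 1 f) :
    ∃ N : ℝ, CriticalBound 0 N (fun t => heat t f) ∧ CriticalBound 1 N (fun t => heat t f) ∧
      ∀ t x, 0 < t → Integrable (fun y => heatKernel t (x - y) • f y) := by
  have hd' : (2 : ℝ) ≤ d := by exact_mod_cast hd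
  obtain ⟨A, hA, hfA⟩ := hf.exists_norm_le (by omega)
  obtain ⟨C, hC, hH⟩ := exists_norm_heat_le (d := d) (by omega) zero_le_one (by linarith)
  have key : ∀ t x, 0 < t → (‖x‖ + Real.sqrt t) * ‖heat t f x‖ ≤ C * A := fun t x ht => by
    have hr := Real.sqrt_pos.2 ht
    have := (hH f A hf.1 hA hfA t x ht).2
    rwa [Real.rpow_neg_one, ← div_eq_mul_inv, le_div_iff₀ (by positivity), mul_comm] at this
  refine ⟨C * A, fun t x ht => ?_, fun t x ht => ?_, fun t x ht => (hH f A hf.1 hA hfA t x ht).1⟩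
  · rw [Real.rpow_zero, one_mul, sub_zero, ← Real.sqrt_eq_rpow]
    refine le_trans ?_ (key t x ht)
    gcongr
    linarith [norm_nonneg x]
  · rw [Real.rpow_one, sub_self, zero_div, Real.rpow_zero, mul_one]
    refine le_trans ?_ (key t x ht)
    gcongr
    linarith [Real.sqrt_nonneg t]

lemma exists_rpow_mul_norm_heat_le (hd : 1 ≤ d) {β : ℝ} (hβ0 : 0 ≤ β) (hβ : β < d)
    {f : Space d → Space d} (hf : MemWeightedLinfty β f) :
    ∃ N : ℝ, ∀ t x, 0 < t → ‖x‖ ^ β * ‖heat t f x‖ ≤ N := by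
  obtain ⟨A, hA, hfA⟩ := hf.exists_norm_le hd
  obtain ⟨C, hC, hH⟩ := exists_norm_heat_le hd hβ0 hβ
  refine ⟨C * A, fun t x ht => ?_⟩
  have hr := Real.sqrt_pos.2 ht
  have := (hH f A hf.1 hA hfA t x ht).2
  rw [Real.rpow_neg (by positivity), ← div_eq_mul_inv, le_div_iff₀ (by positivity),
    mul_comm] at this
  refine le_trans ?_ this
  gcongr
  linarith

end WeightedNS

end

theorem mainTheorem3 (d : ℕ) (hd : 2 ≤ d) (α : ℝ) (hα0 : 0 < α) (hα1 : α < 1) :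
    ∃ δ : ℝ, 0 < δ ∧
      ∀ β : ℝ, 1 ≤ β → β < (d : ℝ) →
      ∀ u₀ : WeightedNS.Space d → WeightedNS.Space d,
        WeightedNS.MemWeightedLinfty 1 u₀ →
        WeightedNS.MemWeightedLinfty β u₀ →
        WeightedNS.DivFree u₀ →
        (∀ (x : WeightedNS.Space d) (t : ℝ), 0 < t →
          ‖x‖ ^ α * t ^ ((1 - α) / 2) * ‖WeightedNS.heat t u₀ x‖ ≤ δ) →
        ∃ u : ℝ → WeightedNS.Space d → WeightedNS.Space d,
          WeightedNS.IsGlobalMildSolution u₀ u ∧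
          (∃ C : ℝ, ∀ (x : WeightedNS.Space d) (t : ℝ), 0 < t →
            (‖x‖ + t ^ ((1 : ℝ) / 2)) * ‖u t x‖ ≤ C) ∧
          (∀ T : ℝ, 0 < T → ∃ C : ℝ, ∀ (x : WeightedNS.Space d) (t : ℝ), 0 < t → t < T →
            ‖x‖ ^ β * ‖u t x‖ ≤ C) := by
  open WeightedNS in
  obtain ⟨C, hC0, hC⟩ := exists_isDuhamelConstant hd hα0 hα1
  refine ⟨1 / (8 * C), by positivity, fun β hβ1 hβd u₀ h1 hβ _ hsmall => ?_⟩
  have hδ : 8 * C * (1 / (8 * C)) ≤ 1 := by rw [mul_one_div_cancel (by positivity)]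
  set w : ℝ → Space d → Space d := fun t => heat t u₀ with hw_def
  -- the heat flow does not change if `u₀` is replaced by a strongly measurable representative
  have hw : Measurable fun p : ℝ × Space d => w p.1 p.2 := by
    have h := measurable_heat h1.1.stronglyMeasurable_mk
    convert h using 2 with p
    refine integral_congr_ae ?_
    filter_upwards [h1.1.ae_eq_mk] with y hy
    rw [← hy]
  have hwα : CriticalBound α (1 / (8 * C)) w := fun t x ht => hsmall x t ht
  obtain ⟨N, hw0, hw1, hwi⟩ := exists_criticalBound_heat hd h1
  obtain ⟨N₀, hwβ⟩ := exists_rpow_mul_norm_heat_le (by omega) (by linarith) hβd hβ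
  have b0 := criticalBound_picard_of_small hC hw hδ hwα (Or.inl rfl) hw0
  have b1 := criticalBound_picard_of_small hC hw hδ hwα (Or.inr (Or.inr rfl)) hw1
  obtain ⟨u, hum, hlim, hu⟩ := exists_tendsto_picard hC hw hδ hwα hw0
  have u0 : CriticalBound 0 (2 * N) u := .of_tendsto b0 hlim
  have u1 : CriticalBound 1 (2 * N) u := .of_tendsto b1 hlim
  obtain ⟨L, lam, hL, hlam, hLp⟩ := exists_pow_mul_norm_picard_le (by omega) hβ1 hβd hw
    (b0 0).nonneg b0 b1 hwβ
  refine ⟨u, fun T _ => ⟨hum.aestronglyMeasurable, fun t ht x => hwi t x ht.1,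
    fun t ht x => (hu t x ht.1).1, fun t ht x => ?_⟩, ⟨2 * N + 2 * N, fun x t ht => ?_⟩,
    fun T _ => ⟨L * Real.exp (lam * T), fun x t ht htT => ?_⟩⟩
  · rw [(hu t x ht.1).2, ← duhamel_eq_intervalIntegral ht.1 (hu t x ht.1).1]
  · have e0 := u0 t x ht
    have e1 := u1 t x ht
    rw [Real.rpow_zero, one_mul, sub_zero] at e0
    rw [Real.rpow_one, sub_self, zero_div, Real.rpow_zero, mul_one] at e1
    rw [add_mul]
    exact add_le_add e1 e0
  · have : ‖x‖ ^ β * ‖u t x‖ ≤ L * Real.exp (lam * t) :=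
      le_of_tendsto ((hlim t x).norm.const_mul _) (.of_forall fun n => hLp n t x ht)
    refine this.trans ?_
    gcongr
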